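/- A coherence space $X=(|X|,\sim_X)$ is a finite or countable set $|X|$ (the web) with a reflexive symmetric relation $\sim_X$; a clique is a set of pairwise coherent tokens, and cliques are ordered by inclusion; two cliques are compatible if their union is a clique. A function from the cliques of $X$ to the cliques of $Y$ is stable if it is Scott-continuous and preserves intersections of compatible cliques, and linear if it is moreover strict and preserves unions of compatible cliques; its trace is $\mathrm{tr}(f)=\{(a,b)\mid b\in f(\{a\})\}$. $\mathbf{Coh}$ is the category of coherence spaces and linear functions. Let $X\otimes Y$ have web $|X|\times|Y|$ with componentwise coherence; let $\mathbf 1$ have one token; let $X\multimap Y$ have web $|X|\times|Y|$ with $(a,b)\sim(a',b')$ iff $a\sim a'$ implies $b\sim b'$ and ($b=b'\Rightarrow a=a'$); let $X\times Y$ have web $|X|+|Y|$, tokens of different components being coherent; let $\top$ have empty web; let $!X$ have as web the finite cliques of $X$, coherence being compatibility. Equip these with the evident monoidal structure maps, currying, evaluation, projections and pairing, and with $!f$, $\varepsilon,\delta,q,d,e$ given by: $(s,t)\in\mathrm{tr}(!f)$ iff every $a\in s$ has some $b\in t$ with $(a,b)\in\mathrm{tr}(f)$ and every $b\in t$ has some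 $a\in s$ with $(a,b)\in\mathrm{tr}(f)$; $\mathrm{tr}(\varepsilon)=\{(\{a\},a)\}$; $\mathrm{tr}(\delta)=\{(\bigcup S,S)\}$; $\mathrm{tr}(q_{X,Y})=\{((\pi_1u,\pi_2u),u)\}$; $\mathrm{tr}(q_{\mathbf 1})=\{(*,\emptyset),(*,\{*\})\}$; $\mathrm{tr}(d)=\{(s\cup t,(s,t))\}$; $\mathrm{tr}(e)=\{(\emptyset,*)\}$. Let $N$ be the flat coherence space of natural numbers ($m\sim n$ iff $m=n$), with the evident $0$, $succ$, with $\mathrm{tr}(pred)=\{(n+1,n)\}$, $\mathrm{tr}(p)=\{(n,\{n\})\}\cup\{(n,\emptyset)\}$ for $p:N\to{!N}$, $\mathrm{tr}(c_N)=\{(n,(n,n))\}$, $\mathrm{tr}(w_N)=\{(n,*)\}$, and let $\ell if:N\otimes(N\times N)\to N$ send $(0,(m_1,m_2))$ to $m_1$ and $(n+1,(m_1,m_2))$ to $m_2$. A linear category is a symmetric monoidal closed category with a symmetric monoidal comonad $(!,\delta,\varepsilon,q)$ and monoidal natural transformations $d_A:{!A}\to{!A}\otimes{!A}$, $e_A:{!A}\to\mathbf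 1$ which make every $!A$ a commutative comonoid and are coalgebra morphisms, such that every coalgebra morphism between free coalgebras is a comonoid morphism. An $\mathcal S\ell\lambda$-category is a linear category together with: a $!$-coalgebra $(N,p)$ with a commutative comonoid structure $(c_N,w_N)$ and maps $0:\mathbf 1\to N$, $succ,pred:N\to N$ such that $pred\circ(n+1)=n$ for all numerals $n:\mathbf 1\to N$, such that $0$ and $succ$ are coalgebra and comonoid morphisms and $p$ is a comonoid morphism; finite products and a map $\ell if:N\otimes(N\times N)\to N$ with $\ell if\circ(0\otimes\langle f,g\rangle)=f$ and $\ell if\circ((n+1)\otimes\langle f,g\rangle)=g$ (modulo $\mathbf 1\cong\mathbf 1\otimes\mathbf 1$) for all $f,g:\mathbf 1\to N$; a Kleisli category of $!$ that is cartesian closed; and maps $fix_B:{!(!B\multimap B)}\to B$ with $fix_B=\mathrm{eval}\circ(\varepsilon\otimes({!fix_B}\circ\delta))\circ d$ for every object $B$. The $\mathcal S\ell\lambda$-calculus has types $\sigma::=\iota\mid\sigma\multimap\sigma$, variables $x^\sigma$ (ground if $\sigma=\iota$, higher-order otherwise) and stable variables $F^\sigma$, and the following typing rules, where bases $\Gamma,\Delta$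 are lists of distinct variables; each rule is given with its interpretation in an $\mathcal S\ell\lambda$-category, where $[\![\iota]\!]=N$, $[\![\sigma\multimap\tau]\!]=[\![\sigma]\!]\multimap[\![\tau]\!]$, a basis is interpreted by the tensor product of $[\![\sigma]\!]$ for each $x^\sigma$ and ${![\![\sigma]\!]}$ for each $F^\sigma$, and the structural isomorphisms of $\otimes$ are left implicit. Axioms $\vdash 0:\iota$ (interpreted by $0$), $\vdash succ,pred:\iota\multimap\iota$ (the curryings of $succ$, $pred$), $x^\sigma\vdash x:\sigma$ (identity), $F^\sigma\vdash F:\sigma$ ($\varepsilon$); exchange of variables (symmetry); weakening and contraction of ground variables ($w_N$, $c_N$) and of stable variables ($e$, $d$); from $\Gamma\vdash M:\sigma\multimap\tau$ and $\Delta\vdash N:\sigma$, with $\Gamma,\Delta$ disjoint, $\Gamma,\Delta\vdash MN:\tau$ ($\mathrm{eval}\circ([\![M]\!]\otimes[\![N]\!])$); from $\Gamma\vdash M:\iota$ and $\Delta\vdash L,R:\iota$, with $\Gamma,\Delta$ disjoint, $\Gamma,\Delta\vdash\ell if\,M\,L\,R:\iota$ ($\ell if\circ([\![M]\!]\otimes\langle[\![L]\!],[\![R]\!]\rangle)$);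 from $\Gamma,x^\sigma\vdash M:\tau$, $\Gamma\vdash\lambda x.M:\sigma\multimap\tau$ (currying); and, if $\Gamma$ consists of ground and $\Delta$ of stable variables, from $\Gamma,\Delta,F^\sigma\vdash M:\sigma$, $\Gamma,\Delta\vdash\mu F.M:\sigma$ ($fix\circ{!f}\circ q\circ(p\otimes\cdots\otimes p\otimes\delta\otimes\cdots\otimes\delta)$ with $f$ the currying of $[\![M]\!]$). **Theorem.** There are linear functions $fix_B:{!({!B}\multimap B)}\to B$, one for every coherence space $B$, such that: 1. for every clique $t$ of ${!B}\multimap B$, $fix_B$ maps the clique of ${!({!B}\multimap B)}$ of all finite subsets of $t$ to the least clique $y$ of $B$ with $y=\{b\mid \exists s\subseteq y \text{ finite},\ (s,b)\in t\}$; 2. $\mathbf{Coh}$ with all the operations above and $fix$ is an $\mathcal S\ell\lambda$-category (in particular, a linear category); 3. the interpretation of the $\mathcal S\ell\lambda$-calculus in this $\mathcal S\ell\lambda$-category is the concrete model of the calculus in coherence spaces. Precisely: for every derivation of $\Gamma\vdash M:\sigma$, with categorical interpretation $[\![\Gamma\vdash M:\sigma]\!]:[\![\Gamma]\!]\to[\![\sigma]\!]$,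 and every environment $\rho$ assigning to each variable of $\Gamma$ a clique of the interpretation of its type, and to each ground variable a clique $\{n\}$, the function $[\![\Gamma\vdash M:\sigma]\!]$ maps the tensor product of the cliques $\rho(x)$ (for a stable variable, of the clique of all finite subsets of $\rho(x)$) to $[\![M]\!]\rho$. Here $[\![0]\!]\rho=\{0\}$, $[\![succ]\!]\rho=\{(n,n+1)\}$, $[\![pred]\!]\rho=\{(n+1,n)\}$, $[\![x]\!]\rho=\rho(x)$ for every kind of variable, $[\![\lambda x.M]\!]\rho=\{(a,b)\mid b\in[\![M]\!]\rho[x:=\{a\}]\}$, $[\![MN]\!]\rho=\{b\mid\exists a\in[\![N]\!]\rho,\ (a,b)\in[\![M]\!]\rho\}$, $[\![\ell if\,M\,L\,R]\!]\rho$ consists of the elements of $[\![L]\!]\rho$ if $0\in[\![M]\!]\rho$ and of the elements of $[\![R]\!]\rho$ if some $n+1\in[\![M]\!]\rho$, and $[\![\mu F.M]\!]\rho=\bigcup_n\Phi^n(\emptyset)$ with $\Phi(s)=[\![M]\!]\rho[F:=s]$. -/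

import Mathlib

open CategoryTheory MonoidalCategory

universe v u

namespace Sll

/-! ## Linear categories -/

section LinearCategories

variable (C : Type u) [Category.{v} C] [MonoidalCategory.{v} C] [SymmetricCategory C]
  [MonoidalClosed C]

/-- A linear category, over a given symmetric monoidal closed category: a symmetric monoidal
comonad `!` together with commutative comonoid structures on the free coalgebras `!A`. The
comultiplication of `!A` is written `d A` and its counit `e A` below. -/
structure LinearCategory where
  /-- the exponential comonad, with `bang.δ` and `bang.ε` -/
  bang : Comonad C
  /-- the natural maps `q : !A ⊗ !B ⟶ !(A ⊗ B)` and `q : 𝟙 ⟶ !𝟙`; `!` is a symmetric monoidal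
  functor -/
  [lax : bang.toFunctor.LaxBraided]
  [δ_monoidal : NatTrans.IsMonoidal bang.δ]
  [ε_monoidal : NatTrans.IsMonoidal bang.ε]
  /-- every free coalgebra is a comonoid -/
  [comon : ∀ A : C, ComonObj (bang.obj A)]
  /-- and this comonoid is commutative -/
  [comm : ∀ A : C, IsCommComonObj (bang.obj A)]
  d_natural : ∀ {A B : C} (f : A ⟶ B),
    bang.map f ≫ ComonObj.comul = ComonObj.comul ≫ (bang.map f ⊗ₘ bang.map f)
  e_natural : ∀ {A B : C} (f : A ⟶ B), bang.map f ≫ ComonObj.counit = ComonObj.counit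
  d_tensor : ∀ A B : C,
    Functor.LaxMonoidal.μ bang.toFunctor A B ≫ ComonObj.comul (X := bang.obj (A ⊗ B)) =
      (ComonObj.comul ⊗ₘ ComonObj.comul) ≫ tensorμ _ _ _ _ ≫
        (Functor.LaxMonoidal.μ bang.toFunctor A B ⊗ₘ Functor.LaxMonoidal.μ bang.toFunctor A B)
  d_unit : Functor.LaxMonoidal.ε bang.toFunctor ≫ ComonObj.comul (X := bang.obj (𝟙_ C)) =
    (λ_ (𝟙_ C)).inv ≫
      (Functor.LaxMonoidal.ε bang.toFunctor ⊗ₘ Functor.LaxMonoidal.ε bang.toFunctor)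
  e_tensor : ∀ A B : C,
    Functor.LaxMonoidal.μ bang.toFunctor A B ≫ ComonObj.counit (X := bang.obj (A ⊗ B)) =
      (ComonObj.counit ⊗ₘ ComonObj.counit) ≫ (λ_ (𝟙_ C)).hom
  e_unit : Functor.LaxMonoidal.ε bang.toFunctor ≫ ComonObj.counit (X := bang.obj (𝟙_ C)) = 𝟙 _
  /-- `d A` is a coalgebra morphism from `!A` to `!A ⊗ !A` -/
  d_coalgebra : ∀ A : C,
    ComonObj.comul ≫ (bang.δ.app A ⊗ₘ bang.δ.app A) ≫
        Functor.LaxMonoidal.μ bang.toFunctor (bang.obj A) (bang.obj A) =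
      bang.δ.app A ≫ bang.map (ComonObj.comul (X := bang.obj A))
  /-- `e A` is a coalgebra morphism from `!A` to `𝟙` -/
  e_coalgebra : ∀ A : C,
    ComonObj.counit (X := bang.obj A) ≫ Functor.LaxMonoidal.ε bang.toFunctor =
      bang.δ.app A ≫ bang.map (ComonObj.counit (X := bang.obj A))
  /-- coalgebra morphisms between free coalgebras are comonoid morphisms -/
  isComonHom_of_coalgebra : ∀ {A B : C} (f : bang.obj A ⟶ bang.obj B),
    f ≫ bang.δ.app B = bang.δ.app A ≫ bang.map f → IsComonHom f

attribute [instance] LinearCategory.lax LinearCategory.δ_monoidal LinearCategory.ε_monoidal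
  LinearCategory.comon LinearCategory.comm

end LinearCategories

section SllCategories

variable {C : Type u} [Category.{v} C] [MonoidalCategory.{v} C]

/-- The numerals `n : 𝟙 ⟶ N` generated by zero and successor. -/
def numeral {N : C} (zero : 𝟙_ C ⟶ N) (succ : N ⟶ N) : ℕ → (𝟙_ C ⟶ N)
  | 0 => zero
  | n + 1 => numeral zero succ n ≫ succ

/-- `N` is a monoidal object of numerals. -/
structure MonoidalNumerals (N : C) where
  zero : 𝟙_ C ⟶ N
  succ : N ⟶ N
  pred : N ⟶ N
  numeral_pred : ∀ n, numeral zero succ (n + 1) ≫ pred = numeral zero succ n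

variable [SymmetricCategory C] [MonoidalClosed C]

/-- An exponential object of numerals: a coalgebra `(N, p)` for `!`. The unit `𝟙` is a coalgebra
through `q : 𝟙 ⟶ !𝟙`, and it is a comonoid in the canonical way. -/
structure ExponentialNumerals (L : LinearCategory C) where
  coalg : L.bang.Coalgebra
  num : MonoidalNumerals coalg.A
  /-- `w` and `c` are the counit and the comultiplication -/
  [comon : ComonObj coalg.A]
  [comm : IsCommComonObj coalg.A]
  zero_coalgebra : num.zero ≫ coalg.a =
    Functor.LaxMonoidal.ε L.bang.toFunctor ≫ L.bang.map num.zero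
  succ_coalgebra : num.succ ≫ coalg.a = coalg.a ≫ L.bang.map num.succ
  zero_comon : letI := ComonObj.instTensorUnit C; IsComonHom num.zero
  succ_comon : IsComonHom num.succ
  p_comon : IsComonHom (N := L.bang.obj coalg.A) coalg.a

attribute [instance] ExponentialNumerals.comon ExponentialNumerals.comm

/-- Currying on the right, `Hom(Z ⊗ A, B) → Hom(Z, A ⊸ B)`. -/
def rcurry {Z A B : C} (f : Z ⊗ A ⟶ B) : Z ⟶ (ihom A).obj B :=
  MonoidalClosed.curry ((β_ A Z).hom ≫ f)

/-- Evaluation, `(A ⊸ B) ⊗ A ⟶ B`. -/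
def reval (A B : C) : (ihom A).obj B ⊗ A ⟶ B :=
  (β_ ((ihom A).obj B) A).hom ≫ (ihom.ev A).app B

/-- The structure that makes a linear category an `Sℓλ`-category. -/
structure SllStructure (L : LinearCategory C) where
  nums : ExponentialNumerals L
  /-- finite products, given by a terminal object and binary products -/
  top : C
  isTerminal : Limits.IsTerminal top
  prod : C → C → C
  fst : ∀ A B, prod A B ⟶ A
  snd : ∀ A B, prod A B ⟶ B
  isProd : ∀ A B, Limits.IsLimit (Limits.BinaryFan.mk (fst A B) (snd A B))
  /-- the conditional -/
  lif : nums.coalg.A ⊗ prod nums.coalg.A nums.coalg.A ⟶ nums.coalg.A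
  lif_zero : ∀ f g : 𝟙_ C ⟶ nums.coalg.A,
    (λ_ (𝟙_ C)).inv ≫ (nums.num.zero ⊗ₘ (isProd _ _).lift (Limits.BinaryFan.mk f g)) ≫ lif = f
  lif_succ : ∀ (n : ℕ) (f g : 𝟙_ C ⟶ nums.coalg.A),
    (λ_ (𝟙_ C)).inv ≫ (numeral nums.num.zero nums.num.succ (n + 1) ⊗ₘ
      (isProd _ _).lift (Limits.BinaryFan.mk f g)) ≫ lif = g
  /-- the (co-)Kleisli category of `!` is cartesian closed -/
  kleisli_cartesianClosed : ∃ _ : CartesianMonoidalCategory (Cokleisli L.bang),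
    Nonempty (MonoidalClosed (Cokleisli L.bang))
  /-- the fixpoint operator -/
  fix : ∀ B : C, L.bang.obj ((ihom (L.bang.obj B)).obj B) ⟶ B
  fix_eq : ∀ B : C, fix B =
    ComonObj.comul ≫ (L.bang.ε.app _ ⊗ₘ (L.bang.δ.app _ ≫ L.bang.map (fix B))) ≫
      reval (L.bang.obj B) B

end SllCategories

/-! ## The operations of an `Sℓλ`-category, without the laws -/

/-- The objects and morphisms that an `Sℓλ`-category consists of. No law is imposed here: the
record serves to say *which* structure is carried by a category, and it is all that the
interpretation of the calculus needs. -/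
structure SllData (C : Type u) [Category.{v} C] where
  tens : C → C → C
  unit : C
  tensHom : ∀ {A A' B B' : C}, (A ⟶ A') → (B ⟶ B') → (tens A B ⟶ tens A' B')
  assoc : ∀ A B D : C, tens (tens A B) D ≅ tens A (tens B D)
  lunit : ∀ A : C, tens unit A ≅ A
  runit : ∀ A : C, tens A unit ≅ A
  braid : ∀ A B : C, tens A B ≅ tens B A
  lolli : C → C → C
  curry : ∀ {Z A B : C}, (tens Z A ⟶ B) → (Z ⟶ lolli A B)
  eval : ∀ A B : C, tens (lolli A B) A ⟶ B
  bang : C → C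
  bangMap : ∀ {A B : C}, (A ⟶ B) → (bang A ⟶ bang B)
  ε : ∀ A : C, bang A ⟶ A
  δ : ∀ A : C, bang A ⟶ bang (bang A)
  q : ∀ A B : C, tens (bang A) (bang B) ⟶ bang (tens A B)
  qUnit : unit ⟶ bang unit
  d : ∀ A : C, bang A ⟶ tens (bang A) (bang A)
  e : ∀ A : C, bang A ⟶ unit
  N : C
  zero : unit ⟶ N
  succ : N ⟶ N
  pred : N ⟶ N
  p : N ⟶ bang N
  c : N ⟶ tens N N
  w : N ⟶ unit
  top : C
  prod : C → C → C
  fst : ∀ A B : C, prod A B ⟶ A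
  snd : ∀ A B : C, prod A B ⟶ B
  pair : ∀ {Z A B : C}, (Z ⟶ A) → (Z ⟶ B) → (Z ⟶ prod A B)
  lif : tens N (prod N N) ⟶ N
  fix : ∀ B : C, bang (lolli (bang B) B) ⟶ B

/-- The operations of an `Sℓλ`-category. -/
def SllStructure.data {C : Type u} [Category.{v} C] [MonoidalCategory.{v} C] [SymmetricCategory C]
    [MonoidalClosed C] {L : LinearCategory C} (S : SllStructure L) : SllData C where
  tens A B := A ⊗ B
  unit := 𝟙_ C
  tensHom f g := f ⊗ₘ g
  assoc A B D := α_ A B D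
  lunit A := λ_ A
  runit A := ρ_ A
  braid A B := β_ A B
  lolli A B := (ihom A).obj B
  curry f := rcurry f
  eval A B := reval A B
  bang A := L.bang.obj A
  bangMap f := L.bang.map f
  ε A := L.bang.ε.app A
  δ A := L.bang.δ.app A
  q A B := Functor.LaxMonoidal.μ L.bang.toFunctor A B
  qUnit := Functor.LaxMonoidal.ε L.bang.toFunctor
  d A := ComonObj.comul (X := L.bang.obj A)
  e A := ComonObj.counit (X := L.bang.obj A)
  N := S.nums.coalg.A
  zero := S.nums.num.zero
  succ := S.nums.num.succ
  pred := S.nums.num.pred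
  p := S.nums.coalg.a
  c := ComonObj.comul (X := S.nums.coalg.A)
  w := ComonObj.counit (X := S.nums.coalg.A)
  top := S.top
  prod := S.prod
  fst := S.fst
  snd := S.snd
  pair f g := (S.isProd _ _).lift (Limits.BinaryFan.mk f g)
  lif := S.lif
  fix := S.fix

/-! ## Coherence spaces and linear functions -/

/-- A coherence space: a finite or countable web with a reflexive symmetric relation. -/
structure Coh where
  web : Type
  [countable : Countable web]
  coh : web → web → Prop
  refl : ∀ a, coh a a
  symm : ∀ {a b}, coh a b → coh b a

attribute [instance] Coh.countable

/-- Sets of pairwise coherent tokens. -/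
def IsClique (X : Coh) (s : Set X.web) : Prop := ∀ a ∈ s, ∀ b ∈ s, X.coh a b

/-- The cliques of a coherence space. -/
@[ext] structure Clique (X : Coh) where
  carrier : Set X.web
  isClique : IsClique X carrier

namespace Clique

variable {X Y : Coh}

/-- Cliques are ordered by inclusion. -/
instance : PartialOrder (Clique X) := PartialOrder.lift Clique.carrier (fun _ _ => Clique.ext)

theorem le_def {x y : Clique X} : x ≤ y ↔ x.carrier ⊆ y.carrier := Iff.rfl

/-- The empty clique. -/
def empty (X : Coh) : Clique X := ⟨∅, by intro a h; exact h.elim⟩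

/-- The clique consisting of one token. -/
def single (a : X.web) : Clique X :=
  ⟨{a}, by rintro b rfl c rfl; exact X.refl _⟩

/-- The intersection of two cliques. -/
def inter (x y : Clique X) : Clique X :=
  ⟨x.carrier ∩ y.carrier, fun a ha b hb => x.isClique a ha.1 b hb.1⟩

/-- Two cliques are compatible when their union is a clique. -/
def Compatible (x y : Clique X) : Prop := IsClique X (x.carrier ∪ y.carrier)

/-- The union of two compatible cliques. -/
def union (x y : Clique X) (h : Compatible x y) : Clique X := ⟨x.carrier ∪ y.carrier, h⟩

end Clique

/-- Stable functions: continuous functions that preserve intersections of compatible cliques. -/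
structure IsStable {X Y : Coh} (f : Clique X → Clique Y) : Prop where
  continuous : ScottContinuous f
  inter : ∀ x y : Clique X, x.Compatible y → f (x.inter y) = (f x).inter (f y)

/-- Linear functions: stable functions that are strict and preserve unions of compatible
cliques. -/
structure IsLinear {X Y : Coh} (f : Clique X → Clique Y) : Prop extends IsStable f where
  strict : f (Clique.empty X) = Clique.empty Y
  union : ∀ (x y : Clique X) (h : x.Compatible y),
    (f (x.union y h)).carrier = (f x).carrier ∪ (f y).carrier

/-- The morphisms of the category of coherence spaces. -/
@[ext] structure LinMap (X Y : Coh) where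
  toFun : Clique X → Clique Y
  isLinear : IsLinear toFun

theorem IsLinear.id (X : Coh) : IsLinear (fun x : Clique X => x) where
  continuous := ScottContinuous.id
  inter _ _ _ := rfl
  strict := rfl
  union _ _ _ := rfl

theorem IsLinear.comp {X Y Z : Coh} {g : Clique Y → Clique Z} {f : Clique X → Clique Y}
    (hg : IsLinear g) (hf : IsLinear f) : IsLinear (fun x => g (f x)) where
  continuous := ScottContinuous.comp (g := g) hf.continuous hg.continuous
  inter x y h := by
    have hc : (f x).Compatible (f y) := by
      have := (f (x.union y h)).isClique
      rwa [hf.union x y h] at this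
    rw [hf.inter x y h, hg.inter _ _ hc]
  strict := by rw [hf.strict, hg.strict]
  union x y h := by
    have hc : (f x).Compatible (f y) := by
      have := (f (x.union y h)).isClique
      rwa [hf.union x y h] at this
    have : f (x.union y h) = (f x).union (f y) hc := Clique.ext (hf.union x y h)
    rw [this, hg.union]

/-- The category of coherence spaces and linear functions. -/
instance : Category Coh where
  Hom := LinMap
  id X := ⟨fun x => x, IsLinear.id X⟩
  comp f g := ⟨fun x => g.toFun (f.toFun x), g.isLinear.comp f.isLinear⟩

/-- The trace of a linear function. -/
def tr {X Y : Coh} (f : X ⟶ Y) (a : X.web) (b : Y.web) : Prop :=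
  b ∈ (LinMap.toFun f (Clique.single a)).carrier

/-- The relations between webs that are traces of linear functions. -/
def IsTrace (X Y : Coh) (R : X.web → Y.web → Prop) : Prop :=
  ∀ a a' b b', X.coh a a' → R a b → R a' b' → Y.coh b b' ∧ (b = b' → a = a')

theorem isTrace_tr {X Y : Coh} (f : X ⟶ Y) : IsTrace X Y (tr f) := by
  intro a a' b b' h hb hb'
  have hc : (Clique.single a).Compatible (Clique.single a') := by
    rintro c (rfl | rfl) d (rfl | rfl)
    · exact X.refl _
    · exact h
    · exact X.symm h
    · exact X.refl _
  have hU := (LinMap.isLinear f).union _ _ hc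
  have hI := (LinMap.isLinear f).inter _ _ hc
  constructor
  · have hq := (LinMap.toFun f ((Clique.single a).union (Clique.single a') hc)).isClique
    rw [hU] at hq
    exact hq b (Or.inl hb) b' (Or.inr hb')
  · rintro rfl
    by_contra hne
    have h0 : (Clique.single a).inter (Clique.single a') = Clique.empty X := by
      apply Clique.ext
      ext c
      constructor
      · rintro ⟨rfl, h2⟩
        exact hne h2
      · exact fun h => h.elim
    rw [h0, (LinMap.isLinear f).strict] at hI
    have : b ∈ (Clique.empty Y).carrier := by
      rw [hI]
      exact ⟨hb, hb'⟩
    exact this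

/-- The linear function with a given trace. -/
def ofTrace {X Y : Coh} (R : X.web → Y.web → Prop) (h : IsTrace X Y R) : X ⟶ Y :=
  LinMap.mk
    (fun x => ⟨{b | ∃ a ∈ x.carrier, R a b}, by
      rintro b ⟨a, ha, hab⟩ b' ⟨a', ha', hab'⟩
      exact (h a a' b b' (x.isClique a ha a' ha') hab hab').1⟩)
    { continuous := by
        intro D hD hdir x hx
        have hcl : IsClique X {a | ∃ y ∈ D, a ∈ y.carrier} := by
          rintro a ⟨y, hy, ha⟩ a' ⟨y', hy', ha'⟩
          obtain ⟨z, -, hz, hz'⟩ := hdir y hy y' hy'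
          exact z.isClique a (hz ha) a' (hz' ha')
        have hle : x ≤ ⟨_, hcl⟩ := hx.2 (fun y hy a ha => ⟨y, hy, ha⟩)
        constructor
        · rintro _ ⟨y, hy, rfl⟩ b ⟨a, ha, hab⟩
          exact ⟨a, hx.1 hy ha, hab⟩
        · rintro u hu b ⟨a, ha, hab⟩
          obtain ⟨y, hy, hay⟩ := hle ha
          exact hu ⟨y, hy, rfl⟩ ⟨a, hay, hab⟩
      inter := by
        intro x y hc
        apply Clique.ext
        ext b
        constructor
        · rintro ⟨a, ⟨hx, hy⟩, hab⟩
          exact ⟨⟨a, hx, hab⟩, ⟨a, hy, hab⟩⟩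
        · rintro ⟨⟨a, hx, hab⟩, ⟨a', hy, hab'⟩⟩
          obtain rfl := (h a a' b b (hc a (Or.inl hx) a' (Or.inr hy)) hab hab').2 rfl
          exact ⟨a, ⟨hx, hy⟩, hab⟩
      strict := by
        apply Clique.ext
        ext b
        constructor
        · rintro ⟨_, ha, -⟩
          exact ha
        · exact fun h => h.elim
      union := by
        intro x y hc
        ext b
        constructor
        · rintro ⟨a, ha | ha, hab⟩
          · exact Or.inl ⟨a, ha, hab⟩
          · exact Or.inr ⟨a, ha, hab⟩
        · rintro (⟨a, ha, hab⟩ | ⟨a, ha, hab⟩)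
          · exact ⟨a, Or.inl ha, hab⟩
          · exact ⟨a, Or.inr ha, hab⟩ }

/-- A bijection of webs that preserves and reflects coherence is an isomorphism. -/
def isoOfEquiv {X Y : Coh} (φ : X.web ≃ Y.web) (h : ∀ a a', X.coh a a' ↔ Y.coh (φ a) (φ a')) :
    X ≅ Y where
  hom := ofTrace (fun a b => φ a = b) (by
    rintro a a' _ _ hc rfl rfl
    exact ⟨(h a a').1 hc, fun e => φ.injective e⟩)
  inv := ofTrace (fun b a => φ a = b) (by
    rintro _ _ a a' hc rfl rfl
    exact ⟨(h a a').2 hc, fun e => congrArg φ e⟩)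
  hom_inv_id := by
    apply LinMap.ext
    funext x
    apply Clique.ext
    ext a
    constructor
    · rintro ⟨_, ⟨_, ha', rfl⟩, hb⟩
      obtain rfl := φ.injective hb
      exact ha'
    · exact fun ha => ⟨φ a, ⟨a, ha, rfl⟩, rfl⟩
  inv_hom_id := by
    apply LinMap.ext
    funext x
    apply Clique.ext
    ext b
    constructor
    · rintro ⟨_, ⟨_, hb', rfl⟩, rfl⟩
      exact hb'
    · exact fun hb => ⟨φ.symm b, ⟨b, hb, φ.apply_symm_apply b⟩, φ.apply_symm_apply b⟩

/-! ### The constructions on coherence spaces -/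

/-- `X ⊗ Y` -/
def tensor (X Y : Coh) : Coh where
  web := X.web × Y.web
  coh a b := X.coh a.1 b.1 ∧ Y.coh a.2 b.2
  refl _ := ⟨X.refl _, Y.refl _⟩
  symm h := ⟨X.symm h.1, Y.symm h.2⟩

/-- The unit `𝟙`, with one token. -/
def one : Coh where
  web := Unit
  coh _ _ := True
  refl _ := trivial
  symm _ := trivial

/-- `X ⊸ Y`; its cliques are the traces of linear functions. -/
def lolli (X Y : Coh) : Coh where
  web := X.web × Y.web
  coh a b := X.coh a.1 b.1 → Y.coh a.2 b.2 ∧ (a.2 = b.2 → a.1 = b.1)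
  refl _ := fun _ => ⟨Y.refl _, fun _ => rfl⟩
  symm h := fun hc => ⟨Y.symm (h (X.symm hc)).1, fun e => ((h (X.symm hc)).2 e.symm).symm⟩

/-- The finite cliques. -/
def FinClique (X : Coh) : Type := {s : Finset X.web // IsClique X (s : Set X.web)}

instance (X : Coh) : Countable (FinClique X) := inferInstanceAs (Countable (Subtype _))

/-- `!X`: finite cliques, with compatibility as coherence. -/
def bang (X : Coh) : Coh where
  web := FinClique X
  coh s t := IsClique X ((s.1 : Set X.web) ∪ (t.1 : Set X.web))
  refl s := by rw [Set.union_self]; exact s.2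
  symm h := by rwa [Set.union_comm]

/-- The cartesian product `X × Y`. -/
def withProd (X Y : Coh) : Coh where
  web := X.web ⊕ Y.web
  coh
    | .inl a, .inl b => X.coh a b
    | .inr a, .inr b => Y.coh a b
    | _, _ => True
  refl
    | .inl a => X.refl a
    | .inr a => Y.refl a
  symm {a b} h := by
    rcases a with a | a <;> rcases b with b | b
    · exact X.symm h
    · trivial
    · trivial
    · exact Y.symm h

/-- The terminal object, with no token. -/
def emptyCoh : Coh where
  web := Empty
  coh _ _ := True
  refl _ := trivial
  symm _ := trivial

/-- The flat coherence space of natural numbers. -/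
def natCoh : Coh where
  web := ℕ
  coh m n := m = n
  refl _ := rfl
  symm h := h.symm

/-! ### The morphisms, given by their traces -/

/-- `f ⊗ g` -/
def tensorMap {X X' Y Y' : Coh} (f : X ⟶ X') (g : Y ⟶ Y') : tensor X Y ⟶ tensor X' Y' :=
  ofTrace (fun a b => tr f a.1 b.1 ∧ tr g a.2 b.2) (by
    rintro a a' b b' hc ⟨h1, h2⟩ ⟨h1', h2'⟩
    have H1 := isTrace_tr f _ _ _ _ hc.1 h1 h1'
    have H2 := isTrace_tr g _ _ _ _ hc.2 h2 h2'
    refine ⟨⟨H1.1, H2.1⟩, ?_⟩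
    rintro rfl
    exact Prod.ext (H1.2 rfl) (H2.2 rfl))

def assocIso (X Y Z : Coh) : tensor (tensor X Y) Z ≅ tensor X (tensor Y Z) :=
  isoOfEquiv (Equiv.prodAssoc X.web Y.web Z.web) (fun _ _ => and_assoc)

def lunitIso (X : Coh) : tensor one X ≅ X :=
  isoOfEquiv (Equiv.punitProd X.web) (fun _ _ => (iff_of_eq (true_and _)))

def runitIso (X : Coh) : tensor X one ≅ X :=
  isoOfEquiv (Equiv.prodPUnit X.web) (fun _ _ => (iff_of_eq (and_true _)))

def braidIso (X Y : Coh) : tensor X Y ≅ tensor Y X :=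
  isoOfEquiv (Equiv.prodComm X.web Y.web) (fun _ _ => and_comm)

def curryMap {Z X Y : Coh} (f : tensor Z X ⟶ Y) : Z ⟶ lolli X Y :=
  ofTrace (fun c ab => tr f (c, ab.1) ab.2) (by
    rintro c c' ⟨a, b⟩ ⟨a', b'⟩ hc h h'
    constructor
    · intro ha
      have H := isTrace_tr f _ _ _ _ (show (tensor Z X).coh (c, a) (c', a') from ⟨hc, ha⟩) h h'
      exact ⟨H.1, fun e => (Prod.ext_iff.1 (H.2 e)).2⟩
    · intro e
      obtain ⟨rfl, rfl⟩ := Prod.ext_iff.1 e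
      have H := isTrace_tr f _ _ _ _
        (show (tensor Z X).coh (c, a) (c', a) from ⟨hc, X.refl _⟩) h h'
      exact (Prod.ext_iff.1 (H.2 rfl)).1)

def evalMap (X Y : Coh) : tensor (lolli X Y) X ⟶ Y :=
  ofTrace (fun t b => t.1 = (t.2, b)) (by
    rintro ⟨t, a⟩ ⟨t', a'⟩ b b' ⟨h1, h2⟩ (h : t = (a, b)) (h' : t' = (a', b'))
    subst h
    subst h'
    have H := h1 h2
    refine ⟨H.1, fun e => ?_⟩
    have ha : a = a' := H.2 e
    subst ha
    subst e
    rfl)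

/-- `!f`: its trace relates `s` to `t` when `s` is exactly the set of the tokens that `f` needs to
produce `t`. -/
def bangMap {X Y : Coh} (f : X ⟶ Y) : bang X ⟶ bang Y :=
  ofTrace (fun s t => (∀ a ∈ s.1, ∃ b ∈ t.1, tr f a b) ∧ (∀ b ∈ t.1, ∃ a ∈ s.1, tr f a b)) (by
    rintro s s' t t' hc ⟨h1, h2⟩ ⟨h1', h2'⟩
    have key : ∀ b ∈ (t.1 : Set Y.web) ∪ (t'.1 : Set Y.web),
        ∃ a ∈ (s.1 : Set X.web) ∪ (s'.1 : Set X.web), tr f a b := by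
      rintro b (hb | hb)
      · obtain ⟨a, ha, hab⟩ := h2 b hb
        exact ⟨a, Or.inl ha, hab⟩
      · obtain ⟨a, ha, hab⟩ := h2' b hb
        exact ⟨a, Or.inr ha, hab⟩
    refine ⟨?_, ?_⟩
    · intro b hb b' hb'
      obtain ⟨a, ha, hab⟩ := key b hb
      obtain ⟨a', ha', hab'⟩ := key b' hb'
      exact (isTrace_tr f _ _ _ _ (hc a ha a' ha') hab hab').1
    · rintro rfl
      apply Subtype.ext
      ext a
      constructor
      · intro ha
        obtain ⟨b, hb, hab⟩ := h1 a ha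
        obtain ⟨a', ha', hab'⟩ := h2' b hb
        rwa [(isTrace_tr f _ _ _ _ (hc a (Or.inl ha) a' (Or.inr ha')) hab hab').2 rfl]
      · intro ha
        obtain ⟨b, hb, hab⟩ := h1' a ha
        obtain ⟨a', ha', hab'⟩ := h2 b hb
        rwa [← (isTrace_tr f _ _ _ _ (hc a' (Or.inl ha') a (Or.inr ha)) hab' hab).2 rfl])

/-- The counit (dereliction), with trace `{({a}, a)}`. -/
def counitMap (X : Coh) : bang X ⟶ X :=
  ofTrace (fun s a => s.1 = {a}) (by
    rintro ⟨_, _⟩ ⟨_, _⟩ a a' hc rfl rfl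
    refine ⟨hc a (Or.inl (by simp)) a' (Or.inr (by simp)), ?_⟩
    rintro rfl
    rfl)

/-- The comultiplication (digging), with trace `{(⋃ S, S)}`. -/
def comultMap (X : Coh) : bang X ⟶ bang (bang X) :=
  ofTrace (fun s S => ∀ a, a ∈ s.1 ↔ ∃ t ∈ S.1, a ∈ t.1) (by
    intro s s' S S' hc h h'
    refine ⟨?_, ?_⟩
    · have key : ∀ t ∈ (S.1 : Set (bang X).web) ∪ (S'.1 : Set (bang X).web), ∀ a ∈ t.1,
          a ∈ (s.1 : Set X.web) ∪ (s'.1 : Set X.web) := by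
        rintro t (ht | ht) a ha
        · exact Or.inl ((h a).2 ⟨t, ht, ha⟩)
        · exact Or.inr ((h' a).2 ⟨t, ht, ha⟩)
      rintro t ht t' ht' a (ha | ha) b (hb | hb)
      · exact hc a (key t ht a ha) b (key t ht b hb)
      · exact hc a (key t ht a ha) b (key t' ht' b hb)
      · exact hc a (key t' ht' a ha) b (key t ht b hb)
      · exact hc a (key t' ht' a ha) b (key t' ht' b hb)
    · rintro rfl
      exact Subtype.ext (Finset.ext fun a => (h a).trans (h' a).symm))

/-- `q : !X ⊗ !Y ⟶ !(X ⊗ Y)`: its trace relates the two projections of `u` to `u`. -/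
def qMap (X Y : Coh) : tensor (bang X) (bang Y) ⟶ bang (tensor X Y) :=
  ofTrace (fun st u => (∀ a, a ∈ st.1.1 ↔ ∃ b, (a, b) ∈ u.1) ∧
      (∀ b, b ∈ st.2.1 ↔ ∃ a, (a, b) ∈ u.1)) (by
    rintro ⟨s, t⟩ ⟨s', t'⟩ u u' ⟨hc, hc'⟩ ⟨h1, h2⟩ ⟨h1', h2'⟩
    refine ⟨?_, ?_⟩
    · have key : ∀ ab ∈ (u.1 : Set (Coh.web (tensor X Y))) ∪ (u'.1 : Set (Coh.web (tensor X Y))),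
          ab.1 ∈ (s.1 : Set X.web) ∪ (s'.1 : Set X.web) ∧
            ab.2 ∈ (t.1 : Set Y.web) ∪ (t'.1 : Set Y.web) := by
        rintro ⟨a, b⟩ (h | h)
        · exact ⟨Or.inl ((h1 a).2 ⟨b, h⟩), Or.inl ((h2 b).2 ⟨a, h⟩)⟩
        · exact ⟨Or.inr ((h1' a).2 ⟨b, h⟩), Or.inr ((h2' b).2 ⟨a, h⟩)⟩
      intro x hx y hy
      exact ⟨hc _ (key x hx).1 _ (key y hy).1, hc' _ (key x hx).2 _ (key y hy).2⟩
    · rintro rfl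
      exact Prod.ext (Subtype.ext (Finset.ext fun a => (h1 a).trans (h1' a).symm))
        (Subtype.ext (Finset.ext fun b => (h2 b).trans (h2' b).symm)))

/-- `q : 𝟙 ⟶ !𝟙` -/
def qUnitMap : one ⟶ bang one :=
  ofTrace (fun _ _ => True) (fun _ _ _ _ _ _ _ => ⟨fun _ _ _ _ => trivial, fun _ => rfl⟩)

/-- `d : !X ⟶ !X ⊗ !X`, with trace `{(s ∪ t, (s, t))}`. -/
def dMap (X : Coh) : bang X ⟶ tensor (bang X) (bang X) :=
  ofTrace (fun u st => ∀ a, a ∈ u.1 ↔ a ∈ st.1.1 ∨ a ∈ st.2.1) (by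
    rintro u u' ⟨s, t⟩ ⟨s', t'⟩ hc h h'
    have hu : ∀ a, a ∈ s.1 ∨ a ∈ t.1 → a ∈ (u.1 : Set X.web) ∪ (u'.1 : Set X.web) :=
      fun a ha => Or.inl ((h a).2 ha)
    have hu' : ∀ a, a ∈ s'.1 ∨ a ∈ t'.1 → a ∈ (u.1 : Set X.web) ∪ (u'.1 : Set X.web) :=
      fun a ha => Or.inr ((h' a).2 ha)
    refine ⟨⟨?_, ?_⟩, ?_⟩
    · have k : ∀ a ∈ (s.1 : Set X.web) ∪ (s'.1 : Set X.web),
          a ∈ (u.1 : Set X.web) ∪ (u'.1 : Set X.web) := by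
        rintro a (ha | ha)
        · exact hu a (Or.inl ha)
        · exact hu' a (Or.inl ha)
      exact fun a ha b hb => hc a (k a ha) b (k b hb)
    · have k : ∀ a ∈ (t.1 : Set X.web) ∪ (t'.1 : Set X.web),
          a ∈ (u.1 : Set X.web) ∪ (u'.1 : Set X.web) := by
        rintro a (ha | ha)
        · exact hu a (Or.inr ha)
        · exact hu' a (Or.inr ha)
      exact fun a ha b hb => hc a (k a ha) b (k b hb)
    · intro e
      obtain ⟨rfl, rfl⟩ := Prod.ext_iff.1 e
      exact Subtype.ext (Finset.ext fun a => (h a).trans (h' a).symm))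

/-- `e : !X ⟶ 𝟙`, with trace `{(∅, *)}`. -/
def eMap (X : Coh) : bang X ⟶ one :=
  ofTrace (fun s _ => s.1 = ∅) (by
    intro s s' _ _ _ h h'
    exact ⟨trivial, fun _ => Subtype.ext (h.trans h'.symm)⟩)

def zeroMap : one ⟶ natCoh :=
  ofTrace (fun _ n => n = (0 : ℕ)) (by
    intro _ _ n n' _ h h'
    exact ⟨h.trans h'.symm, fun _ => rfl⟩)

def succMap : natCoh ⟶ natCoh :=
  ofTrace (fun (m n : ℕ) => n = m + 1) (by
    intro m m' n n' (hc : m = m') h h'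
    subst hc
    exact ⟨h.trans h'.symm, fun _ => rfl⟩)

/-- The predecessor, undefined at `0`. -/
def predMap : natCoh ⟶ natCoh :=
  ofTrace (fun (m n : ℕ) => m = n + 1) (by
    intro m m' n n' (hc : m = m') h h'
    exact ⟨Nat.succ_injective (h.symm.trans (hc.trans h')), fun _ => hc⟩)

/-- The coalgebra `p : N ⟶ !N`, with trace `{(n, {n})} ∪ {(n, ∅)}`. -/
def pMap : natCoh ⟶ bang natCoh :=
  ofTrace (fun (n : ℕ) s => s.1 = {n} ∨ s.1 = ∅) (by
    rintro m m' ⟨s, hs⟩ ⟨s', hs'⟩ (hc : m = m') h h'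
    subst hc
    refine ⟨?_, fun _ => rfl⟩
    have k : ∀ a ∈ (s : Set natCoh.web) ∪ (s' : Set natCoh.web), a = m := by
      rintro a (ha | ha)
      · rcases h with h | h <;> (simp only at h; subst h; first | exact Finset.mem_singleton.1 ha | simp at ha)
      · rcases h' with h | h <;> (simp only at h; subst h; first | exact Finset.mem_singleton.1 ha | simp at ha)
    exact fun a ha b hb => (k a ha).trans (k b hb).symm)

/-- `c : N ⟶ N ⊗ N`, `n ↦ (n, n)` -/
def cMap : natCoh ⟶ tensor natCoh natCoh :=
  ofTrace (fun (m : ℕ) n => n = (m, m)) (by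
    rintro m m' _ _ (hc : m = m') rfl rfl
    exact ⟨⟨hc, hc⟩, fun _ => hc⟩)

/-- `w : N ⟶ 𝟙`, `n ↦ *` -/
def wMap : natCoh ⟶ one :=
  ofTrace (fun _ _ => True) (fun _ _ _ _ hc _ _ => ⟨trivial, fun _ => hc⟩)

def fstMap (X Y : Coh) : withProd X Y ⟶ X :=
  ofTrace (fun a b => a = .inl b) (by
    rintro _ _ b b' hc rfl rfl
    exact ⟨hc, fun e => congrArg _ e⟩)

def sndMap (X Y : Coh) : withProd X Y ⟶ Y :=
  ofTrace (fun a b => a = .inr b) (by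
    rintro _ _ b b' hc rfl rfl
    exact ⟨hc, fun e => congrArg _ e⟩)

def pairMap {Z X Y : Coh} (f : Z ⟶ X) (g : Z ⟶ Y) : Z ⟶ withProd X Y :=
  ofTrace (fun c ab => Sum.elim (tr f c) (tr g c) ab) (by
    rintro c c' (_ | _) (_ | _) hc h h'
    · have H := isTrace_tr f _ _ _ _ hc h h'
      exact ⟨H.1, fun e => H.2 (Sum.inl_injective e)⟩
    · exact ⟨trivial, fun e => by cases e⟩
    · exact ⟨trivial, fun e => by cases e⟩
    · have H := isTrace_tr g _ _ _ _ hc h h'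
      exact ⟨H.1, fun e => H.2 (Sum.inr_injective e)⟩)

/-- The conditional `N ⊗ (N × N) ⟶ N`: it sends `(0, (m₁, m₂))` to `m₁` and `(n + 1, (m₁, m₂))`
to `m₂`. -/
def lifMap : tensor natCoh (withProd natCoh natCoh) ⟶ natCoh :=
  ofTrace (fun t m => t = ((0 : ℕ), Sum.inl m) ∨ ∃ n : ℕ, t = (n + 1, Sum.inr m)) (by
    rintro t t' m m' hc (rfl | ⟨n, rfl⟩) (rfl | ⟨n', rfl⟩)
    · exact ⟨hc.2, fun e => by rw [e]⟩
    · exact absurd (show (0 : ℕ) = n' + 1 from hc.1) (by omega)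
    · exact absurd (show n + 1 = (0 : ℕ) from hc.1) (by omega)
    · have h1 : n + 1 = n' + 1 := hc.1
      exact ⟨hc.2, fun e => by rw [e, h1]⟩)

/-- The clique of `!X` of all finite subcliques of `x`. -/
def Clique.promote {X : Coh} (x : Clique X) : Clique (bang X) :=
  ⟨{s | (s.1 : Set X.web) ⊆ x.carrier}, by
    rintro s hs t ht a (ha | ha) b (hb | hb)
    · exact x.isClique a (hs ha) b (hs hb)
    · exact x.isClique a (hs ha) b (ht hb)
    · exact x.isClique a (ht ha) b (hs hb)
    · exact x.isClique a (ht ha) b (ht hb)⟩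

/-- The clique `x ⊗ y`. -/
def Clique.tensor {X Y : Coh} (x : Clique X) (y : Clique Y) : Clique (tensor X Y) :=
  ⟨{c | c.1 ∈ x.carrier ∧ c.2 ∈ y.carrier}, fun a ha b hb =>
    ⟨x.isClique _ ha.1 _ hb.1, y.isClique _ ha.2 _ hb.2⟩⟩

/-- A clique `t` of `!B ⊸ B` acts on the cliques of `B` as a stable function; `y` is a fixpoint of
this function when it is equal to the set of all `b` with `(s, b) ∈ t` for some finite
`s ⊆ y`. -/
def IsFixpoint {B : Coh} (t : Clique (lolli (bang B) B)) (y : Clique B) : Prop :=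
  {b | ∃ s : FinClique B, (s.1 : Set B.web) ⊆ y.carrier ∧ (s, b) ∈ t.carrier} = y.carrier

/-- `fix` sends every `t : !B ⊸ B` to its least fixpoint. -/
def IsLeastFixOperator (fix : ∀ B : Coh, bang (lolli (bang B) B) ⟶ B) : Prop :=
  ∀ (B : Coh) (t : Clique (lolli (bang B) B)),
    IsLeast {y | IsFixpoint t y} (LinMap.toFun (fix B) t.promote)

/-- The operations on the category of coherence spaces, with a given fixpoint operator. -/
def cohData (fix : ∀ B : Coh, bang (lolli (bang B) B) ⟶ B) : SllData Coh where
  tens := tensor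
  unit := one
  tensHom := tensorMap
  assoc := assocIso
  lunit := lunitIso
  runit := runitIso
  braid := braidIso
  lolli := lolli
  curry := curryMap
  eval := evalMap
  bang := bang
  bangMap := bangMap
  ε := counitMap
  δ := comultMap
  q := qMap
  qUnit := qUnitMap
  d := dMap
  e := eMap
  N := natCoh
  zero := zeroMap
  succ := succMap
  pred := predMap
  p := pMap
  c := cMap
  w := wMap
  top := emptyCoh
  prod := withProd
  fst := fstMap
  snd := sndMap
  pair := pairMap
  lif := lifMap
  fix := fix

/-! ## The calculus -/

/-- Types. -/
inductive Ty : Type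
  | nat : Ty
  | arrow : Ty → Ty → Ty

/-- Entries of a basis: a (ground or higher-order) variable, or a stable variable, of some type. -/
inductive Entry : Type
  | var : Ty → Entry
  | stable : Ty → Entry

/-- The type of a variable. -/
def Entry.ty : Entry → Ty
  | .var σ => σ
  | .stable σ => σ

/-- A basis, with nameless variables; the basis `Γ, x` is `x :: Γ`. -/
abbrev Basis := List Entry

/-- Occurrences of an entry in a basis: these are the variables of the calculus. -/
inductive Mem (x : Entry) : Basis → Type
  | head {Γ : Basis} : Mem x (x :: Γ)
  | tail {y : Entry} {Γ : Basis} : Mem x Γ → Mem x (y :: Γ)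

/-- Renamings of variables. -/
def Ren (Γ Δ : Basis) : Type := ∀ x : Entry, Mem x Γ → Mem x Δ

def Ren.lift {Γ Δ : Basis} (y : Entry) (r : Ren Γ Δ) : Ren (y :: Γ) (y :: Δ)
  | _, .head => .head
  | _, .tail m => .tail (r _ m)

/-- The inclusion of `Γ` into `Γ, Δ`. -/
def Ren.left (Γ : Basis) : ∀ Δ : Basis, Ren Γ (Δ ++ Γ)
  | [], _, m => m
  | _ :: Δ, _, m => .tail (Ren.left Γ Δ _ m)

/-- The inclusion of `Δ` into `Γ, Δ`. -/
def Ren.right (Γ : Basis) : ∀ Δ : Basis, Ren Δ (Δ ++ Γ)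
  | _ :: _, _, .head => .head
  | _ :: Δ, _, .tail m => .tail (Ren.right Γ Δ _ m)

/-- The exchange of two neighbouring variables. -/
def Ren.exchange (Γ : Basis) (x y : Entry) :
    ∀ Δ : Basis, Ren (Δ ++ x :: y :: Γ) (Δ ++ y :: x :: Γ)
  | [], _, .head => .tail .head
  | [], _, .tail .head => .head
  | [], _, .tail (.tail m) => .tail (.tail m)
  | _ :: _, _, .head => .head
  | _ :: Δ, _, .tail m => .tail (Ren.exchange Γ x y Δ _ m)

/-- Weakening by one variable. -/
def Ren.weaken (Γ : Basis) (x : Entry) : Ren Γ (x :: Γ) := fun _ m => .tail m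

/-- The identification of the last two variables. -/
def Ren.contract (Γ : Basis) (x : Entry) : Ren (x :: x :: Γ) (x :: Γ)
  | _, .head => .head
  | _, .tail .head => .head
  | _, .tail (.tail m) => .tail m

/-- Terms over a basis, up to renaming of bound variables. How often the variables may be used is
not restricted here but by `Der`. -/
inductive Tm : Basis → Ty → Type
  | zero {Γ : Basis} : Tm Γ .nat
  | succ {Γ : Basis} : Tm Γ (.arrow .nat .nat)
  | pred {Γ : Basis} : Tm Γ (.arrow .nat .nat)
  | lif {Γ : Basis} : Tm Γ .nat → Tm Γ .nat → Tm Γ .nat → Tm Γ .nat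
  | var {Γ : Basis} {σ : Ty} : Mem (.var σ) Γ → Tm Γ σ
  | stable {Γ : Basis} {σ : Ty} : Mem (.stable σ) Γ → Tm Γ σ
  | app {Γ : Basis} {σ τ : Ty} : Tm Γ (.arrow σ τ) → Tm Γ σ → Tm Γ τ
  | lam {Γ : Basis} {σ τ : Ty} : Tm (.var σ :: Γ) τ → Tm Γ (.arrow σ τ)
  | mu {Γ : Basis} {σ : Ty} : Tm (.stable σ :: Γ) σ → Tm Γ σ

def Tm.rename {Γ : Basis} {σ : Ty} : Tm Γ σ → ∀ {Δ : Basis}, Ren Γ Δ → Tm Δ σ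
  | .zero, _, _ => .zero
  | .succ, _, _ => .succ
  | .pred, _, _ => .pred
  | .lif M L R, _, r => .lif (M.rename r) (L.rename r) (R.rename r)
  | .var m, _, r => .var (r _ m)
  | .stable m, _, r => .stable (r _ m)
  | .app M N, _, r => .app (M.rename r) (N.rename r)
  | .lam M, _, r => .lam (M.rename (r.lift _))
  | .mu M, _, r => .mu (M.rename (r.lift _))

/-- The basis `x₁^ι, …, xₙ^ι, F₁^σ₁, …, Fₖ^σₖ` of ground and stable variables. -/
abbrev groundStable (n : ℕ) (Δ : List Ty) : Basis :=
  Δ.map Entry.stable ++ List.replicate n (.var .nat)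

/-- Derivations of typing judgements `Γ ⊢ M : σ`. -/
inductive Der : {Γ : Basis} → {σ : Ty} → Tm Γ σ → Type
  | z : Der (Tm.zero (Γ := []))
  | s : Der (Tm.succ (Γ := []))
  | p : Der (Tm.pred (Γ := []))
  | lif {Γ Δ : Basis} {M : Tm Γ .nat} {L R : Tm Δ .nat} : Der M → Der L → Der R →
      Der (Tm.lif (M.rename (Ren.left Γ Δ)) (L.rename (Ren.right Γ Δ)) (R.rename (Ren.right Γ Δ)))
  | ex {Γ Δ : Basis} {x y : Entry} {τ : Ty} {M : Tm (Δ ++ x :: y :: Γ) τ} : Der M →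
      Der (M.rename (Ren.exchange Γ x y Δ))
  /-- the rules for ground variables and for higher-order variables -/
  | v (σ : Ty) : Der (Tm.var (Γ := [.var σ]) .head)
  | gw {Γ : Basis} {τ : Ty} {M : Tm Γ τ} : Der M → Der (M.rename (Ren.weaken Γ (.var .nat)))
  | gc {Γ : Basis} {τ : Ty} {M : Tm (.var .nat :: .var .nat :: Γ) τ} : Der M →
      Der (M.rename (Ren.contract Γ (.var .nat)))
  | ap {Γ Δ : Basis} {σ τ : Ty} {M : Tm Γ (.arrow σ τ)} {N : Tm Δ σ} : Der M → Der N →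
      Der (Tm.app (M.rename (Ren.left Γ Δ)) (N.rename (Ren.right Γ Δ)))
  | lam {Γ : Basis} {σ τ : Ty} {M : Tm (.var σ :: Γ) τ} : Der M → Der (Tm.lam M)
  | sv (σ : Ty) : Der (Tm.stable (Γ := [.stable σ]) .head)
  | sc {Γ : Basis} {σ τ : Ty} {M : Tm (.stable σ :: .stable σ :: Γ) τ} : Der M →
      Der (M.rename (Ren.contract Γ (.stable σ)))
  | sw {Γ : Basis} {σ τ : Ty} {M : Tm Γ τ} : Der M → Der (M.rename (Ren.weaken Γ (.stable σ)))
  | mu {n : ℕ} {Δ : List Ty} {σ : Ty} {M : Tm (.stable σ :: groundStable n Δ) σ} : Der M →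
      Der (Tm.mu M)

/-! ### The categorical interpretation -/

/-- The interpretation of types. -/
def Ty.interp {C : Type u} (N : C) (arr : C → C → C) : Ty → C
  | .nat => N
  | .arrow σ τ => arr (σ.interp N arr) (τ.interp N arr)

namespace SllData

variable {C : Type u} [Category.{v} C] (D : SllData C)

def ty (σ : Ty) : C := σ.interp D.N D.lolli

def entry : Entry → C
  | .var σ => D.ty σ
  | .stable σ => D.bang (D.ty σ)

/-- The interpretation of a basis; `Γ, x` is interpreted by the tensor product of the
interpretations of `Γ` and of `x`. -/
def basis : Basis → C
  | [] => D.unit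
  | x :: Γ => D.tens (basis Γ) (D.entry x)

/-- The canonical isomorphism `⟦Γ, Δ⟧ ⟶ ⟦Γ⟧ ⊗ ⟦Δ⟧`. -/
def split (Γ : Basis) : ∀ Δ : Basis, D.basis (Δ ++ Γ) ⟶ D.tens (D.basis Γ) (D.basis Δ)
  | [] => (D.runit (D.basis Γ)).inv
  | _ :: Δ => D.tensHom (split Γ Δ) (𝟙 _) ≫ (D.assoc _ _ _).hom

/-- The symmetry of two neighbouring factors. -/
def exchange (Γ : Basis) (x y : Entry) :
    ∀ Δ : Basis, D.basis (Δ ++ y :: x :: Γ) ⟶ D.basis (Δ ++ x :: y :: Γ)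
  | [] => (D.assoc (D.basis Γ) (D.entry x) (D.entry y)).hom ≫
      D.tensHom (𝟙 _) (D.braid _ _).hom ≫ (D.assoc _ _ _).inv
  | _ :: Δ => D.tensHom (exchange Γ x y Δ) (𝟙 _)

/-- The composite of `p ⊗ ⋯ ⊗ p` and `q`. -/
def promoteGround : ∀ n : ℕ,
    D.basis (List.replicate n (.var .nat)) ⟶ D.bang (D.basis (List.replicate n (.var .nat)))
  | 0 => D.qUnit
  | n + 1 => D.tensHom (promoteGround n) D.p ≫ D.q _ _

/-- The composite of `p ⊗ ⋯ ⊗ p ⊗ δ ⊗ ⋯ ⊗ δ` and `q`. -/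
def promote (n : ℕ) : ∀ Δ : List Ty,
    D.basis (groundStable n Δ) ⟶ D.bang (D.basis (groundStable n Δ))
  | [] => D.promoteGround n
  | _ :: Δ => D.tensHom (promote n Δ) (D.δ _) ≫ D.q _ _

/-- The interpretation of a derivation of `Γ ⊢ M : σ` as a morphism `⟦Γ⟧ ⟶ ⟦σ⟧`. -/
def interp : ∀ {Γ : Basis} {σ : Ty} {M : Tm Γ σ}, Der M → (D.basis Γ ⟶ D.ty σ)
  | _, _, _, .z => D.zero
  | _, _, _, .s => D.curry ((D.lunit D.N).hom ≫ D.succ)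
  | _, _, _, .p => D.curry ((D.lunit D.N).hom ≫ D.pred)
  | _, _, _, .lif (Γ := Γ) (Δ := Δ) dM dL dR =>
      D.split Γ Δ ≫ D.tensHom (interp dM) (D.pair (interp dL) (interp dR)) ≫ D.lif
  | _, _, _, .ex (Γ := Γ) (Δ := Δ) (x := x) (y := y) dM => D.exchange Γ x y Δ ≫ interp dM
  | _, _, _, .v σ => (D.lunit (D.ty σ)).hom
  | _, _, _, .gw dM => D.tensHom (𝟙 _) D.w ≫ (D.runit _).hom ≫ interp dM
  | _, _, _, .gc dM => D.tensHom (𝟙 _) D.c ≫ (D.assoc _ _ _).inv ≫ interp dM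
  | _, _, _, .ap (Γ := Γ) (Δ := Δ) dM dN =>
      D.split Γ Δ ≫ D.tensHom (interp dM) (interp dN) ≫ D.eval _ _
  | _, _, _, .lam dM => D.curry (interp dM)
  | _, _, _, .sv σ => (D.lunit (D.bang (D.ty σ))).hom ≫ D.ε (D.ty σ)
  | _, _, _, .sc (σ := σ) dM => D.tensHom (𝟙 _) (D.d (D.ty σ)) ≫ (D.assoc _ _ _).inv ≫ interp dM
  | _, _, _, .sw (σ := σ) dM => D.tensHom (𝟙 _) (D.e (D.ty σ)) ≫ (D.runit _).hom ≫ interp dM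
  | _, _, _, .mu (n := n) (Δ := Δ) (σ := σ) dM =>
      D.promote n Δ ≫ D.bangMap (D.curry (interp dM)) ≫ D.fix (D.ty σ)

end SllData

/-! ### The concrete model in coherence spaces -/

/-- The coherence space of a type. -/
abbrev cohTy (σ : Ty) : Coh := σ.interp natCoh lolli

/-- Set-valued environments. -/
abbrev SetEnv (Γ : Basis) : Type := ∀ x : Entry, Mem x Γ → Set (cohTy x.ty).web

def SetEnv.cons {Γ : Basis} {x : Entry} (ρ : SetEnv Γ) (s : Set (cohTy x.ty).web) :
    SetEnv (x :: Γ)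
  | _, .head => s
  | _, .tail m => ρ _ m

/-- The denotation of a term in an environment. -/
def Tm.den : ∀ {Γ : Basis} {σ : Ty}, Tm Γ σ → SetEnv Γ → Set (cohTy σ).web
  | _, _, .zero, _ => {n : ℕ | n = 0}
  | _, _, .succ, _ => {mn : ℕ × ℕ | mn.2 = mn.1 + 1}
  | _, _, .pred, _ => {mn : ℕ × ℕ | mn.1 = mn.2 + 1}
  | _, _, .lif M L R, ρ => {m : ℕ | ((0 : ℕ) ∈ (M.den ρ : Set ℕ) ∧ m ∈ (L.den ρ : Set ℕ)) ∨
      ((∃ n : ℕ, n + 1 ∈ (M.den ρ : Set ℕ)) ∧ m ∈ (R.den ρ : Set ℕ))}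
  | _, _, .var m, ρ => ρ _ m
  | _, _, .stable m, ρ => ρ _ m
  | _, _, .app (σ := σ) (τ := τ) M N, ρ =>
      {b : (cohTy τ).web | ∃ a ∈ N.den ρ,
        ((a, b) : (cohTy σ).web × (cohTy τ).web) ∈ (M.den ρ : Set ((cohTy σ).web × (cohTy τ).web))}
  | _, _, .lam (σ := σ) (τ := τ) M, ρ =>
      {ab : (cohTy σ).web × (cohTy τ).web | ab.2 ∈ M.den (ρ.cons (x := .var σ) {ab.1})}
  | _, _, .mu (σ := σ) M, ρ => ⋃ n : ℕ, (fun s => M.den (ρ.cons (x := .stable σ) s))^[n] ∅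

/-- Environments: they assign a clique to every variable. -/
abbrev Env (Γ : Basis) : Type := ∀ x : Entry, Mem x Γ → Clique (cohTy x.ty)

/-- Every ground variable is assigned a number. -/
def Env.IsGround {Γ : Basis} (ρ : Env Γ) : Prop :=
  ∀ m : Mem (.var .nat) Γ, ∃ n : ℕ, ρ _ m = Clique.single (X := natCoh) n

/-- The clique of `⟦Γ⟧` given by an environment: the tensor product of the cliques assigned to the
variables, with those of the stable variables promoted. -/
def Env.clique (fix : ∀ B : Coh, bang (lolli (bang B) B) ⟶ B) :
    ∀ Γ : Basis, Env Γ → Clique ((cohData fix).basis Γ)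
  | [], _ => Clique.single (X := one) ()
  | .var σ :: Γ, ρ => Clique.tensor (X := (cohData fix).basis Γ) (Y := cohTy σ)
      (Env.clique fix Γ fun x m => ρ x (.tail m)) (ρ (.var σ) .head)
  | .stable σ :: Γ, ρ => Clique.tensor (X := (cohData fix).basis Γ) (Y := bang (cohTy σ))
      (Env.clique fix Γ fun x m => ρ x (.tail m)) (Clique.promote (ρ (.stable σ) .head))

/-- The categorical interpretation in coherence spaces agrees with the concrete model. -/
def RecoversConcreteModel (fix : ∀ B : Coh, bang (lolli (bang B) B) ⟶ B) : Prop :=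
  ∀ (Γ : Basis) (σ : Ty) (M : Tm Γ σ) (dM : Der M) (ρ : Env Γ), ρ.IsGround →
    (LinMap.toFun ((cohData fix).interp dM) (Env.clique fix Γ ρ)).carrier =
      M.den (fun x m => (ρ x m).carrier)

end Sll

/-! A linear function is determined by its trace: continuity reduces a value to finite subcliques,
while strictness and preservation of compatible unions reduce those to single tokens (`mem_app`).
Hence every operation of the model can be understood through its action on cliques, and each law
becomes an equation between cliques.

The tool for this is a separating family, a set of cliques on which linear functions out of a space
are determined. Promotions `x.promote` separate on `!X`: if a token `b` comes from a minimal finite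
clique `s` under one map, the other map produces `b` from some `s' ⊆ s`, and minimality forces `s' =
s` (`separating_promote`). Separating families are closed under `⊗`, by currying
(`Separating.tens`). The token of `𝟙` and the numerals are separating as well. On such cliques the
operations are transparent: `!f` sends the promotion of `x` to that of `f x`, `δ` promotes once
more, `d` duplicates, `e` erases, `q` combines two promotions, and on a numeral `p`, `c` and `w` act
as promotion, duplication and erasure. The laws of a linear category and of the object of numerals
then follow by evaluating both sides. A coalgebra morphism between free coalgebras sends promotions
to promotions, hence is a comonoid morphism. The co-Kleisli category is that of stable functions; it
is cartesian closed because `!(X × Y)` is isomorphic to `!X ⊗ !Y`.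

The fixpoint operator is the union of a Kleene chain of traces: start with the empty trace and
iterate `f ↦ eval ∘ (ε ⊗ (!f ∘ δ)) ∘ d`, which sends the promotion of `t` to the value of `t` at the
promotion of `f t`. The chain increases, so its union is a trace, and finiteness of the tokens of
`!B` makes it a fixpoint, the least one (`app_fixMap`, `isLeastFixOperator_fixMap`).

Agreement with the concrete model is an induction on derivations (`carrier_app_interp`). Structural
rules act on the clique of an environment as renamings act on the environment; for ground variables
this uses that they hold numerals. In the rule for `μ`, the stages of the Kleene chain are the
iterates of the semantic operator on `∅`. -/

namespace Sll

section

variable {X X' Y Y' Z W : Coh}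

/-! ## Linear functions and their traces -/

/-- The action of a morphism on cliques. -/
def app (f : X ⟶ Y) (x : Clique X) : Clique Y := LinMap.toFun f x

theorem hom_ext_app {f g : X ⟶ Y} (h : ∀ x, app f x = app g x) : f = g :=
  LinMap.ext (funext h)

@[simp] theorem app_comp (f : X ⟶ Y) (g : Y ⟶ Z) (x : Clique X) :
    app (f ≫ g) x = app g (app f x) := rfl

@[simp] theorem app_id (x : Clique X) : app (𝟙 X) x = x := rfl

theorem app_mono (f : X ⟶ Y) {x y : Clique X} (h : x ≤ y) : app f x ≤ app f y :=
  (LinMap.isLinear f).continuous.monotone h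

/-- Every clique is the directed supremum of its finite subcliques, and `f` is Scott-continuous. -/
theorem exists_finite_of_mem_app {f : X ⟶ Y} {x : Clique X} {b : Y.web}
    (hb : b ∈ (app f x).carrier) :
    ∃ y ≤ x, y.carrier.Finite ∧ b ∈ (app f y).carrier := by
  let D : Set (Clique X) := {y | y ≤ x ∧ y.carrier.Finite}
  have hne : D.Nonempty :=
    ⟨Clique.empty X, (fun a h => h.elim : (∅ : Set X.web) ⊆ x.carrier), Set.finite_empty⟩
  have hdir : DirectedOn (· ≤ ·) D := by
    rintro y ⟨hy, hyf⟩ z ⟨hz, hzf⟩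
    refine ⟨⟨y.carrier ∪ z.carrier, fun a ha b hb => x.isClique a ?_ b ?_⟩,
      ⟨Set.union_subset hy hz, hyf.union hzf⟩, Set.subset_union_left, Set.subset_union_right⟩
    · exact Set.union_subset hy hz ha
    · exact Set.union_subset hy hz hb
  have hlub : IsLUB D x := by
    refine ⟨fun y hy => hy.1, fun z hz a ha => ?_⟩
    have : Clique.single a ∈ D :=
      ⟨Set.singleton_subset_iff.2 ha, Set.finite_singleton a⟩
    exact hz this rfl
  have h := (LinMap.isLinear f).continuous hne hdir hlub
  -- The supremum is taken among cliques, so the union of the images must be presented as a clique;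
  -- cutting it down to `app f x` makes that immediate.
  let u : Clique Y := ⟨{b | b ∈ (app f x).carrier ∧ ∃ y ∈ D, b ∈ (app f y).carrier},
    fun a ha b hb => (app f x).isClique a ha.1 b hb.1⟩
  have hu : app f x ≤ u := h.2 (by
    rintro _ ⟨y, hy, rfl⟩ c hc
    exact ⟨app_mono f hy.1 hc, y, hy, hc⟩)
  obtain ⟨-, y, hy, hby⟩ := hu hb
  exact ⟨y, hy.1, hy.2, hby⟩

/-- A linear function is determined by its trace. -/
theorem mem_app {f : X ⟶ Y} {x : Clique X} {b : Y.web} :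
    b ∈ (app f x).carrier ↔ ∃ a ∈ x.carrier, tr f a b := by
  constructor
  · intro hb
    obtain ⟨⟨s, hs⟩, hle, hfin, hb⟩ := exists_finite_of_mem_app hb
    suffices ∃ a ∈ s, tr f a b by
      obtain ⟨a, ha, hab⟩ := this
      exact ⟨a, hle ha, hab⟩
    clear hle
    replace hfin : s.Finite := hfin
    revert hs
    -- Strictness settles the empty clique. Since `insert a s` is a clique, `{a}` and `s` are
    -- compatible and preservation of unions splits off `a`.
    induction s, hfin using Set.Finite.induction_on with
    | empty =>
      intro hs hb
      have : app f ⟨∅, hs⟩ = Clique.empty Y := (LinMap.isLinear f).strict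
      rw [this] at hb
      exact hb.elim
    | @insert a s _ _ ih =>
      intro hs hb
      have hs' : IsClique X s := fun a ha b hb => hs a (Or.inr ha) b (Or.inr hb)
      have hc : (Clique.single a).Compatible ⟨s, hs'⟩ := hs
      have hb' : b ∈ (LinMap.toFun f ((Clique.single a).union ⟨s, hs'⟩ hc)).carrier := hb
      rw [(LinMap.isLinear f).union] at hb'
      rcases hb' with h | h
      · exact ⟨a, Or.inl rfl, h⟩
      · obtain ⟨a', ha', h'⟩ := ih hs' h
        exact ⟨a', Or.inr ha', h'⟩
  · rintro ⟨a, ha, hab⟩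
    exact app_mono f (Clique.le_def.2 (Set.singleton_subset_iff.2 ha)) hab

theorem hom_ext_tr {f g : X ⟶ Y} (h : ∀ a b, tr f a b ↔ tr g a b) : f = g :=
  hom_ext_app fun x => Clique.ext (by ext b; simp only [mem_app, h])

@[simp] theorem tr_ofTrace {R : X.web → Y.web → Prop} {h : IsTrace X Y R} {a : X.web}
    {b : Y.web} : tr (ofTrace R h) a b ↔ R a b :=
  ⟨fun ⟨_, h, hab⟩ => h ▸ hab, fun h => ⟨a, rfl, h⟩⟩

theorem tr_comp {f : X ⟶ Y} {g : Y ⟶ Z} {a : X.web} {c : Z.web} :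
    tr (f ≫ g) a c ↔ ∃ b, tr f a b ∧ tr g b c :=
  mem_app (f := g) (x := app f (Clique.single a))

/-! ## Separating families of cliques -/

/-- A family of cliques of `X` is separating when linear functions on `X` are determined by their
values on the family. -/
def Separating {ι : Type} (v : ι → Clique X) : Prop :=
  ∀ ⦃Z : Coh⦄ ⦃f g : X ⟶ Z⦄, (∀ i, app f (v i) = app g (v i)) → f = g

theorem separating_id (X : Coh) : Separating (fun x : Clique X => x) :=
  fun _ _ _ => hom_ext_app

theorem separating_single (X : Coh) : Separating (fun a : X.web => Clique.single a) :=
  fun _ _ _ h => hom_ext_tr fun a b => by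
    have := congrArg (fun y => b ∈ Clique.carrier y) (h a)
    exact iff_of_eq this

/-- The token of `𝟙`, as a clique. -/
def Clique.star : Clique one := Clique.single (X := one) ()

/-- A number, as a clique. -/
def Clique.num (n : ℕ) : Clique natCoh := Clique.single (X := natCoh) n

theorem separating_star : Separating (fun _ : Unit => Clique.star) := separating_single one

theorem separating_num : Separating Clique.num := separating_single natCoh

theorem Clique.promote_mono {x y : Clique X} (h : x ≤ y) : x.promote ≤ y.promote :=
  fun _ hs => Set.Subset.trans hs h

/-- A finite clique, as a clique. -/
def FinClique.toClique (s : FinClique X) : Clique X := ⟨s.1, s.2⟩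

theorem FinClique.mem_promote_toClique (s : FinClique X) :
    (s : (bang X).web) ∈ s.toClique.promote.carrier := subset_rfl (a := (s.1 : Set X.web))

/-- Linear functions on `!X` are determined by the stable functions on `X` that they define. -/
theorem separating_promote (X : Coh) : Separating (Clique.promote (X := X)) := by
  have key : ∀ {Z : Coh} {f g : bang X ⟶ Z}, (∀ x, app f (Clique.promote x) = app g x.promote) →
      ∀ s b, tr f s b → tr g s b := by
    intro Z f g h s b hs
    -- Passing from `f` to `g` and back gives `s'' ⊆ s' ⊆ s` with both `s''` and `s` producing `b`
    -- under `f`. They are coherent, so the trace condition identifies them, and `s'` is squeezed in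
    -- between.
    have h1 : b ∈ (app f (FinClique.toClique s).promote).carrier :=
      mem_app.2 ⟨s, FinClique.mem_promote_toClique s, hs⟩
    rw [h] at h1
    obtain ⟨s', hs', h2⟩ := mem_app.1 h1
    have h3 : b ∈ (app g (FinClique.toClique s').promote).carrier :=
      mem_app.2 ⟨s', FinClique.mem_promote_toClique s', h2⟩
    rw [← h] at h3
    obtain ⟨s'', hs'', h4⟩ := mem_app.1 h3
    have hsub : (s''.1 : Set X.web) ⊆ s.1 := Set.Subset.trans hs'' hs'
    have hc : (bang X).coh s'' s := by
      rintro a (ha | ha) a' (ha' | ha')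
      · exact s''.2 a ha a' ha'
      · exact s.2 a (hsub ha) a' ha'
      · exact s.2 a ha a' (hsub ha')
      · exact s.2 a ha a' ha'
    have e := (isTrace_tr f s'' s b b hc h4 hs).2 rfl
    have : s' = s := Subtype.ext (Finset.coe_injective
      (Set.Subset.antisymm hs' (e ▸ hs'')))
    exact this ▸ h2
  exact fun Z f g h => hom_ext_tr fun s b => ⟨key h s b, key (fun x => (h x).symm) s b⟩

/-- The action of a clique of `X ⊸ Y` on the cliques of `X`. -/
def Clique.apply (t : Clique (lolli X Y)) (x : Clique X) : Clique Y :=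
  ⟨{b | ∃ a ∈ x.carrier, (a, b) ∈ t.carrier}, by
    rintro b ⟨a, ha, h⟩ b' ⟨a', ha', h'⟩
    exact (t.isClique _ h _ h' (x.isClique a ha a' ha')).1⟩

theorem isTrace_clique (t : Clique (lolli X Y)) :
    IsTrace X Y (fun a b => (a, b) ∈ t.carrier) :=
  fun _ _ _ _ hc h h' => t.isClique _ h _ h' hc

/-- A clique of `X ⊸ Y` is the trace of a linear function whose values are given by `Clique.apply`,
so a family that separates functions also separates these cliques. -/
theorem Separating.clique_ext {ι : Type} {v : ι → Clique X} (hv : Separating v)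
    {t t' : Clique (lolli X Y)} (h : ∀ i, t.apply (v i) = t'.apply (v i)) : t = t' := by
  have e : ofTrace _ (isTrace_clique t) = ofTrace _ (isTrace_clique t') := hv h
  apply Clique.ext
  ext ⟨a, b⟩
  have := congrArg (fun f => tr f a b) e
  exact (tr_ofTrace.symm.trans (iff_of_eq this)).trans tr_ofTrace

@[simp] theorem app_evalMap (t : Clique (lolli X Y)) (x : Clique X) :
    app (evalMap X Y) (t.tensor x) = t.apply x := by
  apply Clique.ext
  ext b
  constructor
  · rintro ⟨⟨_, a⟩, ⟨ht, hx⟩, h : _ = (a, b)⟩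
    exact ⟨a, hx, h ▸ ht⟩
  · rintro ⟨a, ha, h⟩
    exact ⟨((a, b), a), ⟨h, ha⟩, rfl⟩

@[simp] theorem apply_curryMap (f : tensor Z X ⟶ Y) (z : Clique Z) (x : Clique X) :
    (app (curryMap f) z).apply x = app f (z.tensor x) := by
  apply Clique.ext
  ext b
  rw [mem_app]
  constructor
  · rintro ⟨a, ha, c, hc, h⟩
    exact ⟨(c, a), ⟨hc, ha⟩, h⟩
  · rintro ⟨⟨c, a⟩, ⟨hc, ha⟩, h⟩
    exact ⟨a, ha, c, hc, h⟩

/-- Currying splits the problem: `w` identifies the values of the curried maps at each `v i`, and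
then `v` identifies the curried maps. The original maps are recovered on tokens, since a single
token `(a, b)` is the tensor of the cliques `{a}` and `{b}`. -/
theorem Separating.tens {ι κ : Type} {v : ι → Clique X} {w : κ → Clique Y} (hv : Separating v)
    (hw : Separating w) : Separating (fun p : ι × κ => (v p.1).tensor (w p.2)) := by
  intro Z f g h
  have e : curryMap f = curryMap g := hv fun i => hw.clique_ext fun k => by
    simpa using h (i, k)
  refine (separating_single (tensor X Y)) fun ⟨a, b⟩ => ?_
  have : Clique.single (X := tensor X Y) (a, b) =
      (Clique.single a).tensor (Clique.single b) :=
    Clique.ext (Set.ext fun c => Prod.ext_iff)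
  change app f (Clique.single (X := tensor X Y) (a, b)) = app g (Clique.single (X := tensor X Y) (a, b))
  rw [this, ← apply_curryMap, ← apply_curryMap, e]

/-! ## The operations, on cliques -/

@[simp] theorem app_tensorMap (f : X ⟶ X') (g : Y ⟶ Y') (x : Clique X) (y : Clique Y) :
    app (tensorMap f g) (x.tensor y) = (app f x).tensor (app g y) := by
  apply Clique.ext
  ext ⟨b, b'⟩
  show _ ↔ b ∈ (app f x).carrier ∧ b' ∈ (app g y).carrier
  simp only [mem_app]
  constructor
  · rintro ⟨⟨a, a'⟩, ⟨ha, ha'⟩, h, h'⟩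
    exact ⟨⟨a, ha, h⟩, ⟨a', ha', h'⟩⟩
  · rintro ⟨⟨a, ha, h⟩, ⟨a', ha', h'⟩⟩
    exact ⟨(a, a'), ⟨ha, ha'⟩, h, h'⟩

theorem app_isoOfEquiv_inv (φ : X.web ≃ Y.web) (h) (y : Clique Y) :
    (app (isoOfEquiv φ h).inv y).carrier = φ ⁻¹' y.carrier := by
  ext a
  exact ⟨by rintro ⟨_, hb, rfl⟩; exact hb, fun h => ⟨_, h, rfl⟩⟩

/-- The inverse of an isomorphism given by a bijection of webs acts by preimage, which is easy to
compute; this transfers the result to the forward map. -/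
theorem app_hom_eq_iff (e : X ≅ Y) {x : Clique X} {y : Clique Y} :
    app e.hom x = y ↔ app e.inv y = x := by
  constructor
  · rintro rfl
    rw [← app_comp, e.hom_inv_id, app_id]
  · rintro rfl
    rw [← app_comp, e.inv_hom_id, app_id]

@[simp] theorem app_assocIso_inv (x : Clique X) (y : Clique Y) (z : Clique Z) :
    app (assocIso X Y Z).inv (x.tensor (y.tensor z)) = (x.tensor y).tensor z :=
  Clique.ext ((app_isoOfEquiv_inv _ _ _).trans (Set.ext fun _ => and_assoc.symm))

@[simp] theorem app_assocIso_hom (x : Clique X) (y : Clique Y) (z : Clique Z) :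
    app (assocIso X Y Z).hom ((x.tensor y).tensor z) = x.tensor (y.tensor z) :=
  (app_hom_eq_iff _).2 (app_assocIso_inv x y z)

@[simp] theorem app_lunitIso_inv (x : Clique X) :
    app (lunitIso X).inv x = Clique.star.tensor x :=
  Clique.ext ((app_isoOfEquiv_inv _ _ _).trans (Set.ext fun _ => ⟨fun h => ⟨rfl, h⟩, And.right⟩))

@[simp] theorem app_lunitIso_hom (x : Clique X) :
    app (lunitIso X).hom (Clique.star.tensor x) = x :=
  (app_hom_eq_iff _).2 (app_lunitIso_inv x)

@[simp] theorem app_runitIso_inv (x : Clique X) :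
    app (runitIso X).inv x = x.tensor Clique.star :=
  Clique.ext ((app_isoOfEquiv_inv _ _ _).trans (Set.ext fun _ => ⟨fun h => ⟨h, rfl⟩, And.left⟩))

@[simp] theorem app_runitIso_hom (x : Clique X) :
    app (runitIso X).hom (x.tensor Clique.star) = x :=
  (app_hom_eq_iff _).2 (app_runitIso_inv x)

@[simp] theorem app_braidIso_inv (x : Clique X) (y : Clique Y) :
    app (braidIso X Y).inv (y.tensor x) = x.tensor y :=
  Clique.ext ((app_isoOfEquiv_inv _ _ _).trans (Set.ext fun _ => and_comm))

@[simp] theorem app_braidIso_hom (x : Clique X) (y : Clique Y) :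
    app (braidIso X Y).hom (x.tensor y) = y.tensor x :=
  (app_hom_eq_iff _).2 (app_braidIso_inv x y)

/-- Finite subsets of a clique are tokens of its promotion. -/
theorem Clique.exists_mem_promote (x : Clique X) {s : Set X.web} (hs : s.Finite)
    (h : s ⊆ x.carrier) : ∃ t : (bang X).web, t ∈ x.promote.carrier ∧ ∀ a, a ∈ t.1 ↔ a ∈ s := by
  refine ⟨⟨hs.toFinset, fun a ha b hb => ?_⟩, fun a ha => ?_, fun a => hs.mem_toFinset⟩
  · exact x.isClique a (h (hs.mem_toFinset.1 ha)) b (h (hs.mem_toFinset.1 hb))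
  · exact h (hs.mem_toFinset.1 ha)

@[simp] theorem app_bangMap (f : X ⟶ Y) (x : Clique X) :
    app (bangMap f) x.promote = (app f x).promote := by
  apply Clique.ext
  ext t
  constructor
  · rintro ⟨s, hs, -, h⟩ b hb
    obtain ⟨a, ha, hab⟩ := h b hb
    exact mem_app.2 ⟨a, hs ha, hab⟩
  · intro h
    have h' : ∀ b : t.1, ∃ a ∈ x.carrier, tr f a b := fun b => mem_app.1 (h b.2)
    -- The witness must contain only tokens that are needed for `t`, so one antecedent is chosen for
    -- each `b ∈ t` and the finite range of the choice is taken.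
    choose g hg hg' using h'
    obtain ⟨s, hs, hs'⟩ := x.exists_mem_promote (Set.finite_range g)
      (by rintro _ ⟨b, rfl⟩; exact hg b)
    refine ⟨s, hs, fun a ha => ?_, fun b hb => ⟨g ⟨b, hb⟩, (hs' _).2 ⟨_, rfl⟩, hg' _⟩⟩
    obtain ⟨b, rfl⟩ := (hs' a).1 ha
    exact ⟨b, b.2, hg' b⟩

@[simp] theorem app_counitMap (x : Clique X) : app (counitMap X) x.promote = x := by
  apply Clique.ext
  ext a
  constructor
  · rintro ⟨s, hs, h⟩
    exact hs (show a ∈ s.1 by rw [h]; exact Finset.mem_singleton_self a)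
  · intro ha
    obtain ⟨s, hs, h⟩ := x.exists_mem_promote (Set.finite_singleton a)
      (Set.singleton_subset_iff.2 ha)
    exact ⟨s, hs, Finset.ext fun c => (h c).trans Finset.mem_singleton.symm⟩

@[simp] theorem app_comultMap (x : Clique X) :
    app (comultMap X) x.promote = x.promote.promote := by
  apply Clique.ext
  ext S
  constructor
  · rintro ⟨s, hs, h⟩ t ht a ha
    exact hs ((h a).2 ⟨t, ht, ha⟩)
  · intro hS
    obtain ⟨s, hs, h⟩ := x.exists_mem_promote (s := ⋃ t ∈ S.1, (t.1 : Set X.web))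
      (S.1.finite_toSet.biUnion fun t _ => t.1.finite_toSet)
      (Set.iUnion₂_subset fun t ht => hS ht)
    refine ⟨s, hs, fun a => (h a).trans ?_⟩
    simp only [Set.mem_iUnion, Finset.mem_coe, exists_prop]

@[simp] theorem app_qMap (x : Clique X) (y : Clique Y) :
    app (qMap X Y) (x.promote.tensor y.promote) = (x.tensor y).promote := by
  apply Clique.ext
  ext u
  constructor
  · rintro ⟨⟨s, t⟩, ⟨hs, ht⟩, h, h'⟩ ⟨a, b⟩ hab
    exact ⟨hs ((h a).2 ⟨b, hab⟩), ht ((h' b).2 ⟨a, hab⟩)⟩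
  · intro hu
    obtain ⟨s, hs, h⟩ := x.exists_mem_promote (u.1.finite_toSet.image Prod.fst)
      (by rintro _ ⟨c, hc, rfl⟩; exact (hu hc).1)
    obtain ⟨t, ht, h'⟩ := y.exists_mem_promote (u.1.finite_toSet.image Prod.snd)
      (by rintro _ ⟨c, hc, rfl⟩; exact (hu hc).2)
    refine ⟨(s, t), ⟨hs, ht⟩, fun a => (h a).trans ?_, fun b => (h' b).trans ?_⟩
    · exact ⟨fun ⟨c, hc, e⟩ => ⟨c.2, e ▸ hc⟩, fun ⟨b, h⟩ => ⟨_, h, rfl⟩⟩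
    · exact ⟨fun ⟨c, hc, e⟩ => ⟨c.1, e ▸ hc⟩, fun ⟨b, h⟩ => ⟨_, h, rfl⟩⟩

@[simp] theorem app_qUnitMap : app qUnitMap Clique.star = Clique.star.promote :=
  Clique.ext (Set.ext fun _ => ⟨fun _ _ _ => rfl, fun _ => ⟨(), rfl, trivial⟩⟩)

@[simp] theorem app_dMap (x : Clique X) :
    app (dMap X) x.promote = x.promote.tensor x.promote := by
  apply Clique.ext
  ext ⟨s, t⟩
  constructor
  · rintro ⟨u, hu, h⟩
    exact ⟨fun a ha => hu ((h a).2 (Or.inl ha)), fun a ha => hu ((h a).2 (Or.inr ha))⟩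
  · rintro ⟨hs, ht⟩
    obtain ⟨u, hu, h⟩ := x.exists_mem_promote (s.1.finite_toSet.union t.1.finite_toSet)
      (Set.union_subset hs ht)
    exact ⟨u, hu, h⟩

@[simp] theorem app_eMap (x : Clique X) : app (eMap X) x.promote = Clique.star := by
  apply Clique.ext
  ext ⟨⟩
  refine ⟨fun _ => rfl, fun _ => ?_⟩
  obtain ⟨s, hs, h⟩ := x.exists_mem_promote Set.finite_empty (Set.empty_subset _)
  exact ⟨s, hs, Finset.ext fun a => (h a).trans (by simp)⟩

@[simp] theorem app_zeroMap : app zeroMap Clique.star = Clique.num 0 :=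
  Clique.ext (Set.ext fun _ => ⟨fun ⟨_, _, h⟩ => h, fun h => ⟨(), rfl, h⟩⟩)

@[simp] theorem app_succMap (n : ℕ) : app succMap (Clique.num n) = Clique.num (n + 1) :=
  Clique.ext (Set.ext fun _ => ⟨by rintro ⟨_, rfl, h⟩; exact h, fun h => ⟨n, rfl, h⟩⟩)

@[simp] theorem app_predMap (n : ℕ) : app predMap (Clique.num (n + 1)) = Clique.num n :=
  Clique.ext (Set.ext fun _ =>
    ⟨by rintro ⟨_, rfl, h⟩; exact (Nat.succ_injective h).symm, by rintro rfl; exact ⟨_, rfl, rfl⟩⟩)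

-- The subsets of `{n}` are `∅` and `{n}`, exactly the tokens that `p` relates to `n`. The empty
-- clique behaves differently: `p` is strict, whereas the promotion of `∅` contains the token `∅`.
@[simp] theorem app_pMap (n : ℕ) : app pMap (Clique.num n) = (Clique.num n).promote := by
  apply Clique.ext
  ext s
  constructor
  · rintro ⟨_, rfl, h | h⟩ a ha
    · exact Finset.mem_singleton.1 (h ▸ ha)
    · exact absurd (h ▸ ha : a ∈ (∅ : Finset ℕ)) (Finset.notMem_empty a)
  · intro h
    have : s.1 ⊆ {n} := fun a ha => Finset.mem_singleton.2 (h ha)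
    exact ⟨n, rfl, (Finset.subset_singleton_iff.1 this).symm⟩

@[simp] theorem app_cMap (n : ℕ) :
    app cMap (Clique.num n) = (Clique.num n).tensor (Clique.num n) := by
  apply Clique.ext
  ext ⟨a, b⟩
  exact ⟨by rintro ⟨_, rfl, h⟩; exact Prod.ext_iff.1 h, fun h => ⟨n, rfl, Prod.ext_iff.2 h⟩⟩

@[simp] theorem app_wMap (n : ℕ) : app wMap (Clique.num n) = Clique.star :=
  Clique.ext (Set.ext fun _ => ⟨fun _ => rfl, fun _ => ⟨n, rfl, trivial⟩⟩)

/-- The clique of `X × Y` given by two cliques. -/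
def Clique.pair (x : Clique X) (y : Clique Y) : Clique (withProd X Y) :=
  ⟨{c | Sum.elim x.carrier y.carrier c}, by
    rintro (a | a) ha (b | b) hb
    · exact x.isClique a ha b hb
    · trivial
    · trivial
    · exact y.isClique a ha b hb⟩

@[simp] theorem app_fstMap (x : Clique X) (y : Clique Y) :
    app (fstMap X Y) (x.pair y) = x :=
  Clique.ext (Set.ext fun _ => ⟨by rintro ⟨_, h, rfl⟩; exact h, fun h => ⟨_, h, rfl⟩⟩)

@[simp] theorem app_sndMap (x : Clique X) (y : Clique Y) :
    app (sndMap X Y) (x.pair y) = y :=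
  Clique.ext (Set.ext fun _ => ⟨by rintro ⟨_, h, rfl⟩; exact h, fun h => ⟨_, h, rfl⟩⟩)

@[simp] theorem app_pairMap (f : Z ⟶ X) (g : Z ⟶ Y) (z : Clique Z) :
    app (pairMap f g) z = (app f z).pair (app g z) := by
  apply Clique.ext
  ext (a | a)
  · exact (mem_app (f := f)).symm
  · exact (mem_app (f := g)).symm

theorem Clique.pair_fst_snd (u : Clique (withProd X Y)) :
    (app (fstMap X Y) u).pair (app (sndMap X Y) u) = u := by
  apply Clique.ext
  ext (a | a)
  · exact ⟨by rintro ⟨_, h, rfl⟩; exact h, fun h => ⟨_, h, rfl⟩⟩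
  · exact ⟨by rintro ⟨_, h, rfl⟩; exact h, fun h => ⟨_, h, rfl⟩⟩

@[simp] theorem app_lifMap_zero (x y : Clique natCoh) :
    app lifMap ((Clique.num 0).tensor (x.pair y)) = x := by
  apply Clique.ext
  ext m
  constructor
  · rintro ⟨_, ⟨h, h'⟩, rfl | ⟨n, rfl⟩⟩
    · exact h'
    · exact absurd h (Nat.succ_ne_zero n)
  · exact fun h => ⟨((0 : ℕ), Sum.inl m), ⟨rfl, h⟩, Or.inl rfl⟩

@[simp] theorem app_lifMap_succ (n : ℕ) (x y : Clique natCoh) :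
    app lifMap ((Clique.num (n + 1)).tensor (x.pair y)) = y := by
  apply Clique.ext
  ext m
  constructor
  · rintro ⟨_, ⟨h, h'⟩, rfl | ⟨n, rfl⟩⟩
    · exact absurd h.symm (Nat.succ_ne_zero n)
    · exact h'
  · exact fun h => ⟨(n + 1, Sum.inr m), ⟨rfl, h⟩, Or.inr ⟨n, rfl⟩⟩

/-- The guard is an arbitrary clique, possibly empty, because the guard of a conditional term may be
undefined. -/
theorem mem_app_lifMap {k : Clique natCoh} {x y : Clique natCoh} {m : ℕ} :
    (m : natCoh.web) ∈ (app lifMap (k.tensor (x.pair y))).carrier ↔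
      ((0 : ℕ) ∈ (k.carrier : Set ℕ) ∧ m ∈ (x.carrier : Set ℕ)) ∨
        (∃ n : ℕ, n + 1 ∈ (k.carrier : Set ℕ)) ∧ m ∈ (y.carrier : Set ℕ) := by
  constructor
  · rintro ⟨_, ⟨h, h'⟩, rfl | ⟨n, rfl⟩⟩
    · exact Or.inl ⟨h, h'⟩
    · exact Or.inr ⟨⟨n, h⟩, h'⟩
  · rintro (⟨h, h'⟩ | ⟨⟨n, h⟩, h'⟩)
    · exact ⟨((0 : ℕ), Sum.inl m), ⟨h, h'⟩, Or.inl rfl⟩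
    · exact ⟨(n + 1, Sum.inr m), ⟨h, h'⟩, Or.inr ⟨n, rfl⟩⟩

end

/-! ## The symmetric monoidal closed category of coherence spaces -/

instance : MonoidalCategoryStruct Coh where
  tensorObj := tensor
  whiskerLeft X _ _ f := tensorMap (𝟙 X) f
  whiskerRight f Y := tensorMap f (𝟙 Y)
  tensorHom := tensorMap
  tensorUnit := one
  associator := assocIso
  leftUnitor := lunitIso
  rightUnitor := runitIso

/-- The monoidal laws are all checked on tensor products of cliques, bracketed as in the domain.
There the structural maps only rebracket or permute factors, and a unit factor needs only the clique
`Clique.star`. -/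
theorem tensorMap_id (X Y : Coh) : tensorMap (𝟙 X) (𝟙 Y) = 𝟙 (tensor X Y) :=
  ((separating_id X).tens (separating_id Y)) fun _ => by simp

theorem tensorMap_comp {X₁ X₂ Y₁ Y₂ Z₁ Z₂ : Coh} (f₁ : X₁ ⟶ Y₁) (f₂ : X₂ ⟶ Y₂) (g₁ : Y₁ ⟶ Z₁)
    (g₂ : Y₂ ⟶ Z₂) :
    tensorMap f₁ f₂ ≫ tensorMap g₁ g₂ = tensorMap (f₁ ≫ g₁) (f₂ ≫ g₂) :=
  ((separating_id _).tens (separating_id _)) fun _ => by simp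

theorem assocIso_naturality {X₁ X₂ X₃ Y₁ Y₂ Y₃ : Coh} (f₁ : X₁ ⟶ Y₁) (f₂ : X₂ ⟶ Y₂)
    (f₃ : X₃ ⟶ Y₃) :
    tensorMap (tensorMap f₁ f₂) f₃ ≫ (assocIso Y₁ Y₂ Y₃).hom =
      (assocIso X₁ X₂ X₃).hom ≫ tensorMap f₁ (tensorMap f₂ f₃) :=
  (((separating_id _).tens (separating_id _)).tens (separating_id _)) fun _ => by simp

theorem lunitIso_naturality {X Y : Coh} (f : X ⟶ Y) :
    tensorMap (𝟙 one) f ≫ (lunitIso Y).hom = (lunitIso X).hom ≫ f :=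
  (separating_star.tens (separating_id _)) fun _ => by simp

theorem runitIso_naturality {X Y : Coh} (f : X ⟶ Y) :
    tensorMap f (𝟙 one) ≫ (runitIso Y).hom = (runitIso X).hom ≫ f :=
  ((separating_id _).tens separating_star) fun _ => by simp

theorem assocIso_pentagon (W X Y Z : Coh) :
    tensorMap (assocIso W X Y).hom (𝟙 Z) ≫ (assocIso W (tensor X Y) Z).hom ≫
        tensorMap (𝟙 W) (assocIso X Y Z).hom =
      (assocIso (tensor W X) Y Z).hom ≫ (assocIso W X (tensor Y Z)).hom :=
  ((((separating_id _).tens (separating_id _)).tens (separating_id _)).tens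
    (separating_id _)) fun _ => by simp

theorem assocIso_triangle (X Y : Coh) :
    (assocIso X one Y).hom ≫ tensorMap (𝟙 X) (lunitIso Y).hom =
      tensorMap (runitIso X).hom (𝟙 Y) :=
  (((separating_id _).tens separating_star).tens (separating_id _)) fun _ => by simp

instance : MonoidalCategory Coh :=
  .ofTensorHom (id_tensorHom_id := tensorMap_id) (id_tensorHom := fun _ _ _ _ => rfl)
    (tensorHom_id := fun _ _ => rfl) (tensorHom_comp_tensorHom := tensorMap_comp)
    (associator_naturality := assocIso_naturality) (leftUnitor_naturality := lunitIso_naturality)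
    (rightUnitor_naturality := runitIso_naturality) (pentagon := assocIso_pentagon)
    (triangle := assocIso_triangle)

theorem braidIso_naturality {X X' Y Y' : Coh} (f : X ⟶ X') (g : Y ⟶ Y') :
    tensorMap f g ≫ (braidIso X' Y').hom = (braidIso X Y).hom ≫ tensorMap g f :=
  ((separating_id _).tens (separating_id _)) fun _ => by simp

theorem braidIso_hexagon_forward (X Y Z : Coh) :
    (assocIso X Y Z).hom ≫ (braidIso X (tensor Y Z)).hom ≫ (assocIso Y Z X).hom =
      tensorMap (braidIso X Y).hom (𝟙 Z) ≫ (assocIso Y X Z).hom ≫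
        tensorMap (𝟙 Y) (braidIso X Z).hom :=
  (((separating_id _).tens (separating_id _)).tens (separating_id _)) fun _ => by simp

theorem braidIso_hexagon_reverse (X Y Z : Coh) :
    (assocIso X Y Z).inv ≫ (braidIso (tensor X Y) Z).hom ≫ (assocIso Z X Y).inv =
      tensorMap (𝟙 X) (braidIso Y Z).hom ≫ (assocIso X Z Y).inv ≫
        tensorMap (braidIso X Z).hom (𝟙 Y) :=
  ((separating_id _).tens ((separating_id _).tens (separating_id _))) fun _ => by simp

theorem braidIso_symmetry (X Y : Coh) : (braidIso X Y).hom ≫ (braidIso Y X).hom = 𝟙 _ :=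
  ((separating_id _).tens (separating_id _)) fun _ => by simp

instance : SymmetricCategory Coh where
  braiding := braidIso
  braiding_naturality_right X _ _ f := braidIso_naturality (𝟙 X) f
  braiding_naturality_left f Z := braidIso_naturality f (𝟙 Z)
  hexagon_forward := braidIso_hexagon_forward
  hexagon_reverse := braidIso_hexagon_reverse
  symmetry := braidIso_symmetry

/-! ### The closed structure. -/

/-- Uncurrying on the right. -/
def uncurryMap {Z X Y : Coh} (g : Z ⟶ lolli X Y) : tensor Z X ⟶ Y :=
  tensorMap g (𝟙 X) ≫ evalMap X Y

@[simp] theorem app_uncurryMap {Z X Y : Coh} (g : Z ⟶ lolli X Y) (z : Clique Z) (x : Clique X) :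
    app (uncurryMap g) (z.tensor x) = (app g z).apply x := by
  simp [uncurryMap]

theorem Separating.curry_ext {X Y Z : Coh} {ι κ : Type} {v : ι → Clique Z} {w : κ → Clique X}
    (hv : Separating v) (hw : Separating w) {f g : Z ⟶ lolli X Y}
    (h : ∀ i k, (app f (v i)).apply (w k) = (app g (v i)).apply (w k)) : f = g :=
  hv fun i => hw.clique_ext fun k => h i k

/-- The adjunction between the tensor product and the linear function space. -/
def tensorHomEquiv (X Z Y : Coh) : (tensor X Z ⟶ Y) ≃ (Z ⟶ lolli X Y) where
  toFun f := curryMap ((braidIso X Z).inv ≫ f)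
  invFun g := (braidIso X Z).hom ≫ uncurryMap g
  left_inv f := ((separating_id _).tens (separating_id _)) fun _ => by simp
  right_inv g := (separating_id _).curry_ext (separating_id _) fun _ _ => by simp

theorem tensorHomEquiv_naturality (X : Coh) {Z' Z Y : Coh} (f : Z' ⟶ Z) (g : tensor X Z ⟶ Y) :
    tensorHomEquiv X Z' Y (tensorMap (𝟙 X) f ≫ g) = f ≫ tensorHomEquiv X Z Y g :=
  (separating_id _).curry_ext (separating_id _) fun _ _ => by simp [tensorHomEquiv]

instance : MonoidalClosed Coh where
  closed X :=
    { rightAdj := Adjunction.rightAdjointOfEquiv (F := tensorLeft X) (G_obj := lolli X)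
        (tensorHomEquiv X) fun _ _ _ => tensorHomEquiv_naturality X
      adj := Adjunction.adjunctionOfEquivRight (F := tensorLeft X) (G_obj := lolli X)
        (tensorHomEquiv X) fun _ _ _ => tensorHomEquiv_naturality X }

/-- The closed structure curries the left factor, through a braiding built into `tensorHomEquiv`;
the braiding in `rcurry` cancels it. The adjunction returns the hom-set bijection that it was built
from. -/
theorem rcurry_eq {Z X Y : Coh} (f : Z ⊗ X ⟶ Y) : rcurry f = curryMap f := by
  have h : MonoidalClosed.curry ((β_ X Z).hom ≫ f) =
      curryMap ((braidIso X Z).inv ≫ (braidIso X Z).hom ≫ f) := by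
    change (ihom.adjunction X).homEquiv _ _ _ = _
    simp only [ihom.adjunction]
    exact congrFun (congrArg _ (congrFun (congrFun (Adjunction.mkOfHomEquiv_homEquiv _) _) _)) _
  exact h.trans (by rw [Iso.inv_hom_id_assoc])

theorem reval_eq (X Y : Coh) : reval X Y = evalMap X Y := by
  have h : (ihom.ev X).app Y = (braidIso X (lolli X Y)).hom ≫ uncurryMap (𝟙 (lolli X Y)) := rfl
  change (braidIso (lolli X Y) X).hom ≫ (ihom.ev X).app Y = _
  rw [h]
  exact ((separating_id _).tens (separating_id _)) fun _ => by simp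

/-! ## The exponential comonad -/

/-- On promotions the comonad laws are equations between the underlying stable functions, where `ε`
undoes a promotion and `δ` adds one. -/
theorem bangMap_id (X : Coh) : bangMap (𝟙 X) = 𝟙 (bang X) :=
  separating_promote X fun _ => by simp

theorem bangMap_comp {X Y Z : Coh} (f : X ⟶ Y) (g : Y ⟶ Z) :
    bangMap (f ≫ g) = bangMap f ≫ bangMap g :=
  separating_promote X fun _ => by simp

theorem counitMap_naturality {X Y : Coh} (f : X ⟶ Y) :
    bangMap f ≫ counitMap Y = counitMap X ≫ f :=
  separating_promote X fun _ => by simp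

theorem comultMap_naturality {X Y : Coh} (f : X ⟶ Y) :
    bangMap f ≫ comultMap Y = comultMap X ≫ bangMap (bangMap f) :=
  separating_promote X fun _ => by simp

theorem comultMap_coassoc (X : Coh) :
    comultMap X ≫ bangMap (comultMap X) = comultMap X ≫ comultMap (bang X) :=
  separating_promote X fun _ => by simp

theorem comultMap_left_counit (X : Coh) : comultMap X ≫ counitMap (bang X) = 𝟙 _ :=
  separating_promote X fun _ => by simp

theorem comultMap_right_counit (X : Coh) : comultMap X ≫ bangMap (counitMap X) = 𝟙 _ :=
  separating_promote X fun _ => by simp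

/-- The comonad `!`. -/
def bangComonad : Comonad Coh where
  obj := bang
  map := bangMap
  map_id := bangMap_id
  map_comp := bangMap_comp
  ε := { app := counitMap, naturality := fun _ _ => counitMap_naturality }
  δ := { app := comultMap, naturality := fun _ _ => comultMap_naturality }
  coassoc := comultMap_coassoc
  left_counit := comultMap_left_counit
  right_counit := comultMap_right_counit

/-! ### The symmetric monoidal structure of the comonad. -/

theorem qMap_naturality_left {X X' : Coh} (f : X ⟶ X') (Y : Coh) :
    tensorMap (bangMap f) (𝟙 (bang Y)) ≫ qMap X' Y = qMap X Y ≫ bangMap (tensorMap f (𝟙 Y)) :=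
  ((separating_promote X).tens (separating_promote Y)) fun _ => by simp

theorem qMap_naturality_right (X : Coh) {Y Y' : Coh} (g : Y ⟶ Y') :
    tensorMap (𝟙 (bang X)) (bangMap g) ≫ qMap X Y' = qMap X Y ≫ bangMap (tensorMap (𝟙 X) g) :=
  ((separating_promote X).tens (separating_promote Y)) fun _ => by simp

theorem qMap_assoc (X Y Z : Coh) :
    tensorMap (qMap X Y) (𝟙 (bang Z)) ≫ qMap (tensor X Y) Z ≫ bangMap (assocIso X Y Z).hom =
      (assocIso (bang X) (bang Y) (bang Z)).hom ≫ tensorMap (𝟙 (bang X)) (qMap Y Z) ≫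
        qMap X (tensor Y Z) :=
  (((separating_promote X).tens (separating_promote Y)).tens (separating_promote Z))
    fun _ => by simp

theorem qMap_left_unit (X : Coh) :
    (lunitIso (bang X)).hom =
      tensorMap qUnitMap (𝟙 (bang X)) ≫ qMap one X ≫ bangMap (lunitIso X).hom :=
  (separating_star.tens (separating_promote X)) fun _ => by simp

theorem qMap_right_unit (X : Coh) :
    (runitIso (bang X)).hom =
      tensorMap (𝟙 (bang X)) qUnitMap ≫ qMap X one ≫ bangMap (runitIso X).hom :=
  ((separating_promote X).tens separating_star) fun _ => by simp

theorem qMap_braid (X Y : Coh) :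
    qMap X Y ≫ bangMap (braidIso X Y).hom = (braidIso (bang X) (bang Y)).hom ≫ qMap Y X :=
  ((separating_promote X).tens (separating_promote Y)) fun _ => by simp

instance : bangComonad.toFunctor.LaxBraided where
  ε := qUnitMap
  μ := qMap
  μ_natural_left f X := qMap_naturality_left f X
  μ_natural_right X g := qMap_naturality_right X g
  associativity := qMap_assoc
  left_unitality := qMap_left_unit
  right_unitality := qMap_right_unit
  braided := qMap_braid

theorem qMap_comult (X Y : Coh) :
    qMap X Y ≫ comultMap (tensor X Y) =
      tensorMap (comultMap X) (comultMap Y) ≫ qMap (bang X) (bang Y) ≫ bangMap (qMap X Y) :=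
  ((separating_promote X).tens (separating_promote Y)) fun _ => by simp

theorem qUnitMap_comult : qUnitMap ≫ comultMap one = qUnitMap ≫ bangMap qUnitMap :=
  separating_star fun _ => by simp

theorem qMap_counit (X Y : Coh) :
    qMap X Y ≫ counitMap (tensor X Y) = tensorMap (counitMap X) (counitMap Y) :=
  ((separating_promote X).tens (separating_promote Y)) fun _ => by simp

theorem qUnitMap_counit : qUnitMap ≫ counitMap one = 𝟙 one :=
  separating_star fun _ => by simp

/-! ## The comonoid structure of `!X` -/

theorem dMap_counit_left (X : Coh) :
    dMap X ≫ tensorMap (eMap X) (𝟙 (bang X)) = (lunitIso (bang X)).inv :=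
  separating_promote X fun _ => by simp

theorem dMap_counit_right (X : Coh) :
    dMap X ≫ tensorMap (𝟙 (bang X)) (eMap X) = (runitIso (bang X)).inv :=
  separating_promote X fun _ => by simp

theorem dMap_assoc (X : Coh) :
    dMap X ≫ tensorMap (𝟙 (bang X)) (dMap X) =
      dMap X ≫ tensorMap (dMap X) (𝟙 (bang X)) ≫ (assocIso _ _ _).hom :=
  separating_promote X fun _ => by simp

theorem dMap_comm (X : Coh) : dMap X ≫ (braidIso _ _).hom = dMap X :=
  separating_promote X fun _ => by simp

/-- The comonoid structure of `!X`. -/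
instance bangComon (X : Coh) : ComonObj (bangComonad.obj X) where
  counit := eMap X
  comul := dMap X
  counit_comul := dMap_counit_left X
  comul_counit := dMap_counit_right X
  comul_assoc := dMap_assoc X

theorem dMap_naturality {X Y : Coh} (f : X ⟶ Y) :
    bangMap f ≫ dMap Y = dMap X ≫ tensorMap (bangMap f) (bangMap f) :=
  separating_promote X fun _ => by simp

theorem eMap_naturality {X Y : Coh} (f : X ⟶ Y) : bangMap f ≫ eMap Y = eMap X :=
  separating_promote X fun _ => by simp

/-- The exchange of the two factors in the middle. -/
def tensorMid (X₁ X₂ Y₁ Y₂ : Coh) :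
    tensor (tensor X₁ X₂) (tensor Y₁ Y₂) ⟶ tensor (tensor X₁ Y₁) (tensor X₂ Y₂) :=
  (assocIso X₁ X₂ (tensor Y₁ Y₂)).hom ≫ tensorMap (𝟙 X₁) (assocIso X₂ Y₁ Y₂).inv ≫
    tensorMap (𝟙 X₁) (tensorMap (braidIso X₂ Y₁).hom (𝟙 Y₂)) ≫
      tensorMap (𝟙 X₁) (assocIso Y₁ X₂ Y₂).hom ≫ (assocIso X₁ Y₁ (tensor X₂ Y₂)).inv

@[simp] theorem app_tensorMid {X₁ X₂ Y₁ Y₂ : Coh} (x₁ : Clique X₁) (x₂ : Clique X₂)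
    (y₁ : Clique Y₁) (y₂ : Clique Y₂) :
    app (tensorMid X₁ X₂ Y₁ Y₂) ((x₁.tensor x₂).tensor (y₁.tensor y₂)) =
      (x₁.tensor y₁).tensor (x₂.tensor y₂) := by
  simp [tensorMid]

theorem dMap_tensor (X Y : Coh) :
    qMap X Y ≫ dMap (tensor X Y) =
      tensorMap (dMap X) (dMap Y) ≫ tensorMid _ _ _ _ ≫ tensorMap (qMap X Y) (qMap X Y) :=
  ((separating_promote X).tens (separating_promote Y)) fun _ => by simp

theorem dMap_unit :
    qUnitMap ≫ dMap one = (lunitIso one).inv ≫ tensorMap qUnitMap qUnitMap :=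
  separating_star fun _ => by simp

theorem eMap_tensor (X Y : Coh) :
    qMap X Y ≫ eMap (tensor X Y) = tensorMap (eMap X) (eMap Y) ≫ (lunitIso one).hom :=
  ((separating_promote X).tens (separating_promote Y)) fun _ => by simp

theorem eMap_unit : qUnitMap ≫ eMap one = 𝟙 one :=
  separating_star fun _ => by simp

theorem dMap_coalgebra (X : Coh) :
    dMap X ≫ tensorMap (comultMap X) (comultMap X) ≫ qMap (bang X) (bang X) =
      comultMap X ≫ bangMap (dMap X) :=
  separating_promote X fun _ => by simp

theorem eMap_coalgebra (X : Coh) : eMap X ≫ qUnitMap = comultMap X ≫ bangMap (eMap X) :=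
  separating_promote X fun _ => by simp

/-- A coalgebra morphism between free coalgebras preserves promotions. -/
theorem app_promote_of_coalgebra {X Y : Coh} {f : bang X ⟶ bang Y}
    (h : f ≫ comultMap Y = comultMap X ≫ bangMap f) (x : Clique X) :
    app f x.promote = (app (counitMap Y) (app f x.promote)).promote := by
  -- By cofreeness, `f` is the coalgebra extension of `f ≫ ε`; such an extension visibly preserves
  -- promotions.
  have h' : f = comultMap X ≫ bangMap (f ≫ counitMap Y) := by
    rw [bangMap_comp, ← Category.assoc, ← h, Category.assoc, comultMap_right_counit,
      Category.comp_id]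
  have := congrArg (fun g => app g x.promote) h'
  simpa using this

/-- The image of a promotion is again a promotion, and `e` erases every promotion. -/
theorem coalgebra_comp_eMap {X Y : Coh} {f : bang X ⟶ bang Y}
    (h : f ≫ comultMap Y = comultMap X ≫ bangMap f) : f ≫ eMap Y = eMap X :=
  separating_promote X fun x => by
    rw [app_comp, app_promote_of_coalgebra h]; simp

theorem coalgebra_comp_dMap {X Y : Coh} {f : bang X ⟶ bang Y}
    (h : f ≫ comultMap Y = comultMap X ≫ bangMap f) : f ≫ dMap Y = dMap X ≫ tensorMap f f :=
  separating_promote X fun x => by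
    simp only [app_comp, app_dMap, app_tensorMap]
    rw [app_promote_of_coalgebra h, app_dMap]

instance (X : Coh) : IsCommComonObj (bangComonad.obj X) where
  comul_comm := dMap_comm X

/-- Coherence spaces form a linear category. -/
@[reducible] def cohLinear : LinearCategory Coh where
  bang := bangComonad
  δ_monoidal := { unit := qUnitMap_comult, tensor := qMap_comult }
  ε_monoidal := { unit := qUnitMap_counit, tensor := fun X Y => qMap_counit X Y }
  comon := bangComon
  d_natural := dMap_naturality
  e_natural := eMap_naturality
  -- `tensorμ` unfolds to `tensorMid`.
  d_tensor := dMap_tensor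
  d_unit := dMap_unit
  e_tensor := eMap_tensor
  e_unit := eMap_unit
  d_coalgebra := dMap_coalgebra
  e_coalgebra := eMap_coalgebra
  isComonHom_of_coalgebra _ h :=
    { hom_counit := coalgebra_comp_eMap h, hom_comul := coalgebra_comp_dMap h }

/-! ## Numerals -/

/-- Numerals separate on `N`, and on them `p`, `c` and `w` promote, duplicate and erase, so the laws
hold for the same reason as those of `!X`. -/
theorem pMap_counit : pMap ≫ counitMap natCoh = 𝟙 natCoh :=
  separating_num fun _ => by simp

theorem pMap_comult : pMap ≫ comultMap natCoh = pMap ≫ bangMap pMap :=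
  separating_num fun _ => by simp

theorem cMap_counit_left : cMap ≫ tensorMap wMap (𝟙 natCoh) = (lunitIso natCoh).inv :=
  separating_num fun _ => by simp

theorem cMap_counit_right : cMap ≫ tensorMap (𝟙 natCoh) wMap = (runitIso natCoh).inv :=
  separating_num fun _ => by simp

theorem cMap_assoc :
    cMap ≫ tensorMap (𝟙 natCoh) cMap =
      cMap ≫ tensorMap cMap (𝟙 natCoh) ≫ (assocIso _ _ _).hom :=
  separating_num fun _ => by simp

theorem cMap_comm : cMap ≫ (braidIso _ _).hom = cMap :=
  separating_num fun _ => by simp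

theorem zeroMap_pMap : zeroMap ≫ pMap = qUnitMap ≫ bangMap zeroMap :=
  separating_star fun _ => by simp

theorem succMap_pMap : succMap ≫ pMap = pMap ≫ bangMap succMap :=
  separating_num fun _ => by simp

theorem zeroMap_wMap : zeroMap ≫ wMap = 𝟙 one :=
  separating_star fun _ => by simp

theorem zeroMap_cMap : zeroMap ≫ cMap = (lunitIso one).inv ≫ tensorMap zeroMap zeroMap :=
  separating_star fun _ => by simp

theorem succMap_wMap : succMap ≫ wMap = wMap :=
  separating_num fun _ => by simp

theorem succMap_cMap : succMap ≫ cMap = cMap ≫ tensorMap succMap succMap :=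
  separating_num fun _ => by simp

theorem pMap_eMap : pMap ≫ eMap natCoh = wMap :=
  separating_num fun _ => by simp

theorem pMap_dMap : pMap ≫ dMap natCoh = cMap ≫ tensorMap pMap pMap :=
  separating_num fun _ => by simp

@[simp] theorem app_numeral (n : ℕ) :
    app (numeral (C := Coh) (N := natCoh) zeroMap succMap n) Clique.star = Clique.num n := by
  induction n with
  | zero => exact app_zeroMap
  | succ n ih =>
    change app succMap (app (numeral (C := Coh) (N := natCoh) zeroMap succMap n) _) = _
    rw [ih, app_succMap]

theorem numeral_predMap (n : ℕ) :
    numeral (C := Coh) (N := natCoh) zeroMap succMap (n + 1) ≫ predMap =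
      numeral (C := Coh) (N := natCoh) zeroMap succMap n :=
  separating_star fun _ => by
    rw [app_comp, app_numeral, app_predMap, app_numeral]

/-- The coalgebra of numerals. -/
def natCoalgebra : bangComonad.Coalgebra where
  A := natCoh
  a := pMap
  counit := pMap_counit
  coassoc := pMap_comult

instance : ComonObj natCoalgebra.A where
  counit := wMap
  comul := cMap
  counit_comul := cMap_counit_left
  comul_counit := cMap_counit_right
  comul_assoc := cMap_assoc

instance : IsCommComonObj natCoalgebra.A where
  comul_comm := cMap_comm

/-- The monoidal object of numerals. -/
def natNumerals : MonoidalNumerals natCoalgebra.A where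
  zero := zeroMap
  succ := succMap
  pred := predMap
  numeral_pred := numeral_predMap

/-- The exponential object of numerals in coherence spaces. -/
@[reducible] def cohNumerals : ExponentialNumerals cohLinear where
  coalg := natCoalgebra
  num := natNumerals
  zero_coalgebra := zeroMap_pMap
  succ_coalgebra := succMap_pMap
  zero_comon :=
    letI := ComonObj.instTensorUnit Coh
    { hom_counit := zeroMap_wMap, hom_comul := zeroMap_cMap }
  succ_comon := { hom_counit := succMap_wMap, hom_comul := succMap_cMap }
  p_comon := { hom_counit := pMap_eMap, hom_comul := pMap_dMap }

/-! ## Products -/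

theorem pairMap_fst {X Y Z : Coh} (f : Z ⟶ X) (g : Z ⟶ Y) : pairMap f g ≫ fstMap X Y = f :=
  hom_ext_app fun _ => by simp

theorem pairMap_snd {X Y Z : Coh} (f : Z ⟶ X) (g : Z ⟶ Y) : pairMap f g ≫ sndMap X Y = g :=
  hom_ext_app fun _ => by simp

theorem eq_pairMap {X Y Z : Coh} (h : Z ⟶ withProd X Y) :
    h = pairMap (h ≫ fstMap X Y) (h ≫ sndMap X Y) :=
  hom_ext_app fun z => by simp [Clique.pair_fst_snd]

/-- `X × Y` is the product of `X` and `Y`. -/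
def withProdIsLimit (X Y : Coh) :
    Limits.IsLimit (Limits.BinaryFan.mk (fstMap X Y) (sndMap X Y)) :=
  Limits.BinaryFan.IsLimit.mk _ (fun f g => pairMap f g) (fun f g => pairMap_fst f g)
    (fun f g => pairMap_snd f g) (fun f g h hf hg => by
      subst hf
      subst hg
      exact eq_pairMap h)

/-- The morphism with empty trace. -/
def botMap (X Y : Coh) : X ⟶ Y :=
  ofTrace (fun _ _ => False) (fun _ _ _ _ _ h _ => h.elim)

/-- The coherence space without tokens is terminal. -/
def emptyCohIsTerminal : Limits.IsTerminal emptyCoh :=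
  .ofUniqueHom (fun X => botMap X emptyCoh) fun _ _ => hom_ext_tr fun _ b => b.elim

theorem lifMap_zero (f g : one ⟶ natCoh) :
    (lunitIso one).inv ≫ tensorMap zeroMap (pairMap f g) ≫ lifMap = f :=
  separating_star fun _ => by simp

/-- Replacing the numeral by any `m` with the same value keeps its recursive definition out of the
computation. -/
theorem comp_lifMap_of_num_succ {m : one ⟶ natCoh} {n : ℕ}
    (h : app m Clique.star = Clique.num (n + 1)) (f g : one ⟶ natCoh) :
    (lunitIso one).inv ≫ tensorMap m (pairMap f g) ≫ lifMap = g :=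
  separating_star fun _ => by simp [h]

theorem lifMap_succ (n : ℕ) (f g : one ⟶ natCoh) :
    (lunitIso one).inv ≫ tensorMap (numeral (C := Coh) (N := natCoh) zeroMap succMap (n + 1))
      (pairMap f g) ≫ lifMap = g :=
  comp_lifMap_of_num_succ (app_numeral (n + 1)) f g

/-! ## The co-Kleisli category -/

/-- Co-Kleisli composition is composition of stable functions. It is computed in `Coh`, and the
statements about `Cokleisli` unfold to it. -/
theorem app_promote_comp {X Y Z : Coh} (f : bang X ⟶ Y) (g : bang Y ⟶ Z) (x : Clique X) :
    app (comultMap X ≫ bangMap f ≫ g) x.promote = app g (app f x.promote).promote := by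
  simp

theorem app_pairMap_counitMap_fst {X Y Z : Coh} (f : Z ⟶ X) (g : Z ⟶ Y) (z : Clique Z) :
    app (counitMap _ ≫ fstMap X Y) (app (pairMap f g) z).promote = app f z := by
  simp

theorem app_pairMap_counitMap_snd {X Y Z : Coh} (f : Z ⟶ X) (g : Z ⟶ Y) (z : Clique Z) :
    app (counitMap _ ≫ sndMap X Y) (app (pairMap f g) z).promote = app g z := by
  simp

theorem app_eq_app_pairMap_counitMap {X Y Z : Coh} (h : bang Z ⟶ withProd X Y) (z : Clique Z) :
    app h z.promote =
      app (pairMap (comultMap Z ≫ bangMap h ≫ counitMap _ ≫ fstMap X Y)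
        (comultMap Z ≫ bangMap h ≫ counitMap _ ≫ sndMap X Y)) z.promote := by
  simp [Clique.pair_fst_snd]

/-- The stable function given by a morphism of the co-Kleisli category. -/
def kapp {X Y : Cokleisli bangComonad} (f : X ⟶ Y) (x : Clique X.of) : Clique Y.of :=
  app (X := bang X.of) f.of x.promote

theorem kapp_comp {X Y Z : Cokleisli bangComonad} (f : X ⟶ Y) (g : Y ⟶ Z) (x : Clique X.of) :
    kapp (f ≫ g) x = kapp g (kapp f x) :=
  app_promote_comp f.of g.of x

theorem kapp_ext {X Y : Cokleisli bangComonad} {f g : X ⟶ Y} (h : ∀ x, kapp f x = kapp g x) :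
    f = g :=
  Cokleisli.hom_ext _ (separating_promote X.of h)

/-- The linear function `!X ⟶ Y` as a morphism of the co-Kleisli category. -/
def kmk {X Y : Coh} (f : bang X ⟶ Y) : Cokleisli.mk bangComonad X ⟶ Cokleisli.mk bangComonad Y :=
  .mk f

/-- The product of the co-Kleisli category. -/
def kprodCone (X Y : Cokleisli bangComonad) : Limits.LimitCone (Limits.pair X Y) where
  cone := Limits.BinaryFan.mk (P := .mk bangComonad (withProd X.of Y.of))
    (kmk (counitMap _ ≫ fstMap X.of Y.of)) (kmk (counitMap _ ≫ sndMap X.of Y.of))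
  isLimit := Limits.BinaryFan.IsLimit.mk _ (fun f g => kmk (pairMap f.of g.of))
    (fun f g => kapp_ext fun x =>
      (kapp_comp _ _ x).trans (app_pairMap_counitMap_fst f.of g.of x.promote))
    (fun f g => kapp_ext fun x =>
      (kapp_comp _ _ x).trans (app_pairMap_counitMap_snd f.of g.of x.promote))
    (fun f g h hf hg => by
      subst hf
      subst hg
      exact kapp_ext fun x => app_eq_app_pairMap_counitMap h.of x)

/-- The terminal object of the co-Kleisli category. -/
def kterminalCone : Limits.LimitCone (Functor.empty.{0} (Cokleisli bangComonad)) where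
  cone := Limits.asEmptyCone (.mk bangComonad emptyCoh)
  isLimit := Limits.IsTerminal.ofUniqueHom (fun _ => kmk (botMap _ emptyCoh)) fun _ _ =>
    kapp_ext fun _ => Clique.ext (Set.ext fun b => b.elim)

/-- The co-Kleisli category has finite products. -/
@[reducible] def cokleisliCartesian : CartesianMonoidalCategory (Cokleisli bangComonad) :=
  .ofChosenFiniteProducts kterminalCone kprodCone

/-! ### The isomorphism of `!X ⊗ !Y` with `!(X × Y)`, and cartesian closure. -/

theorem separating_promote_pair (X Y : Coh) :
    Separating (fun p : Clique X × Clique Y => (p.1.pair p.2).promote) :=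
  fun _ _ _ h => separating_promote _ fun u => by
    have := h (app (fstMap X Y) u, app (sndMap X Y) u)
    simpa only [Clique.pair_fst_snd] using this

/-- The map `!X ⊗ !Y ⟶ !(X × Y)`. -/
def seelyMap (X Y : Coh) : tensor (bang X) (bang Y) ⟶ bang (withProd X Y) :=
  tensorMap (comultMap X) (comultMap Y) ≫ qMap (bang X) (bang Y) ≫
    bangMap (pairMap (tensorMap (counitMap X) (eMap Y) ≫ (runitIso X).hom)
      (tensorMap (eMap X) (counitMap Y) ≫ (lunitIso Y).hom))

@[simp] theorem app_seelyMap {X Y : Coh} (x : Clique X) (y : Clique Y) :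
    app (seelyMap X Y) (x.promote.tensor y.promote) = (x.pair y).promote := by
  simp [seelyMap]

/-- The inverse `!(X × Y) ⟶ !X ⊗ !Y` of `seelyMap`. -/
def seelyInv (X Y : Coh) : bang (withProd X Y) ⟶ tensor (bang X) (bang Y) :=
  dMap (withProd X Y) ≫ tensorMap (bangMap (fstMap X Y)) (bangMap (sndMap X Y))

@[simp] theorem app_seelyInv {X Y : Coh} (x : Clique X) (y : Clique Y) :
    app (seelyInv X Y) (x.pair y).promote = x.promote.tensor y.promote := by
  simp [seelyInv]

/-- Stable functions on `X × Z` as stable functions on `Z` with values in the stable functions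
on `X`. -/
def stableHomEquiv (X Z Y : Coh) :
    (bang (withProd X Z) ⟶ Y) ≃ (bang Z ⟶ lolli (bang X) Y) where
  toFun f := curryMap ((braidIso _ _).hom ≫ seelyMap X Z ≫ f)
  invFun g := seelyInv X Z ≫ (braidIso _ _).hom ≫ uncurryMap g
  -- `seelyMap` and `seelyInv` exchange the tensor of two promotions with the promotion of the pair,
  -- and these cliques separate on the respective spaces; hence both round trips are trivial.
  left_inv f := separating_promote_pair X Z fun _ => by simp
  right_inv g := (separating_promote Z).curry_ext (separating_promote X) fun _ _ => by simp

@[simp] theorem apply_stableHomEquiv {X Z Y : Coh} (f : bang (withProd X Z) ⟶ Y) (x : Clique X)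
    (z : Clique Z) :
    (app (stableHomEquiv X Z Y f) z.promote).apply x.promote = app f (x.pair z).promote := by
  simp [stableHomEquiv]

/-- Currying in the co-Kleisli category. -/
def cokleisliHomEquiv (X Z Y : Cokleisli bangComonad) :
    (Cokleisli.mk bangComonad (withProd X.of Z.of) ⟶ Y) ≃
      (Z ⟶ Cokleisli.mk bangComonad (lolli (bang X.of) Y.of)) where
  toFun f := .mk (stableHomEquiv X.of Z.of Y.of f.of)
  invFun g := .mk ((stableHomEquiv X.of Z.of Y.of).symm g.of)
  left_inv f := Cokleisli.hom_ext _ ((stableHomEquiv X.of Z.of Y.of).symm_apply_apply f.of)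
  right_inv g := Cokleisli.hom_ext _ ((stableHomEquiv X.of Z.of Y.of).apply_symm_apply g.of)

theorem apply_cokleisliHomEquiv {X Z Y : Cokleisli bangComonad}
    (f : Cokleisli.mk bangComonad (withProd X.of Z.of) ⟶ Y) (x : Clique X.of) (z : Clique Z.of) :
    Clique.apply (X := bang X.of) (Y := Y.of) (kapp (cokleisliHomEquiv X Z Y f) z) x.promote =
      kapp f (x.pair z) :=
  apply_stableHomEquiv f.of x z

/-- Whiskering in a cartesian category is characterised by its two projections, and a clique of a
product is the pair of its projections. -/
theorem kapp_whiskerLeft (X : Cokleisli bangComonad) {Z' Z : Cokleisli bangComonad} (f : Z' ⟶ Z)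
    (x : Clique X.of) (z : Clique Z'.of) :
    letI := cokleisliCartesian
    kapp (X ◁ f) (x.pair z) = x.pair (kapp f z) := by
  let _ := cokleisliCartesian
  have h1 : kapp (X ◁ f ≫ SemiCartesianMonoidalCategory.fst X Z) (x.pair z) =
      kapp (SemiCartesianMonoidalCategory.fst X Z') (x.pair z) :=
    congrArg (fun g => kapp g (x.pair z)) (CartesianMonoidalCategory.whiskerLeft_fst X f)
  have h2 : kapp (X ◁ f ≫ SemiCartesianMonoidalCategory.snd X Z) (x.pair z) =
      kapp (SemiCartesianMonoidalCategory.snd X Z' ≫ f) (x.pair z) :=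
    congrArg (fun g => kapp g (x.pair z)) (CartesianMonoidalCategory.whiskerLeft_snd X f)
  -- The chosen co-Kleisli projections are `ε` followed by the linear ones, and `ε` undoes the
  -- promotion of `u`.
  have e1 : ∀ (Z : Cokleisli bangComonad) (u : Clique (withProd X.of Z.of)),
      kapp (SemiCartesianMonoidalCategory.fst X Z) u = app (fstMap X.of Z.of) u := fun Z u =>
    congrArg (app (fstMap X.of Z.of)) (app_counitMap u)
  have e2 : ∀ (Z : Cokleisli bangComonad) (u : Clique (withProd X.of Z.of)),
      kapp (SemiCartesianMonoidalCategory.snd X Z) u = app (sndMap X.of Z.of) u := fun Z u =>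
    congrArg (app (sndMap X.of Z.of)) (app_counitMap u)
  refine (Clique.pair_fst_snd (X := X.of) (Y := Z.of) _).symm.trans (congrArg₂ Clique.pair ?_ ?_)
  · exact (((e1 Z _).symm.trans (kapp_comp _ _ _).symm).trans h1).trans
      ((e1 Z' _).trans (app_fstMap x z))
  · exact (((e2 Z _).symm.trans (kapp_comp _ _ _).symm).trans h2).trans
      ((kapp_comp _ _ _).trans (congrArg (kapp f) ((e2 Z' _).trans (app_sndMap x z))))

/-- Evaluated at `z` and then at `x`, both sides give the value of `g` at the pair of `x` and `f z`.
-/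
theorem cokleisliHomEquiv_naturality (X : Cokleisli bangComonad) {Z' Z Y : Cokleisli bangComonad}
    (f : Z' ⟶ Z) (g : Cokleisli.mk bangComonad (withProd X.of Z.of) ⟶ Y) :
    letI := cokleisliCartesian
    cokleisliHomEquiv X Z' Y (X ◁ f ≫ g) = f ≫ cokleisliHomEquiv X Z Y g := by
  refine kapp_ext fun z => (separating_promote X.of).clique_ext fun x => ?_
  rw [kapp_comp]
  refine (apply_cokleisliHomEquiv _ x z).trans ?_
  refine Eq.trans ?_ (apply_cokleisliHomEquiv g x (kapp f z)).symm
  exact (kapp_comp _ _ _).trans (congrArg (kapp g) (kapp_whiskerLeft X f x z))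

theorem cokleisli_cartesianClosed : ∃ _ : CartesianMonoidalCategory (Cokleisli bangComonad),
    Nonempty (MonoidalClosed (Cokleisli bangComonad)) :=
  letI := cokleisliCartesian
  ⟨inferInstance, ⟨
    { closed := fun X =>
      { rightAdj := Adjunction.rightAdjointOfEquiv (F := tensorLeft X)
          (G_obj := fun Y => .mk bangComonad (lolli (bang X.of) Y.of))
          (cokleisliHomEquiv X) fun _ _ _ => cokleisliHomEquiv_naturality X
        adj := Adjunction.adjunctionOfEquivRight (F := tensorLeft X)
          (G_obj := fun Y => .mk bangComonad (lolli (bang X.of) Y.of))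
          (cokleisliHomEquiv X) fun _ _ _ => cokleisliHomEquiv_naturality X } }⟩⟩

/-! ## Fixpoints -/

/-- The operator that has `fix` as its least fixpoint. -/
def stepMap {B : Coh} (f : bang (lolli (bang B) B) ⟶ B) : bang (lolli (bang B) B) ⟶ B :=
  dMap _ ≫ tensorMap (counitMap _) (comultMap _ ≫ bangMap f) ≫ evalMap (bang B) B

@[simp] theorem app_stepMap {B : Coh} (f : bang (lolli (bang B) B) ⟶ B)
    (t : Clique (lolli (bang B) B)) :
    app (stepMap f) t.promote = t.apply (app f t.promote).promote := by
  simp [stepMap]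

/-- The trace of `f` enters that of `stepMap f` only through `!f`, and there only positively. -/
theorem stepMap_mono {B : Coh} {f g : bang (lolli (bang B) B) ⟶ B}
    (h : ∀ s b, tr f s b → tr g s b) (s : (bang (lolli (bang B) B)).web) (b : B.web)
    (hs : tr (stepMap f) s b) : tr (stepMap g) s b := by
  obtain ⟨u, hu, hs⟩ := tr_comp.1 hs
  obtain ⟨v, hv, hs⟩ := tr_comp.1 hs
  obtain ⟨h1, h2⟩ := tr_ofTrace.1 hv
  obtain ⟨w, hw, h2⟩ := tr_comp.1 h2
  obtain ⟨h3, h4⟩ := tr_ofTrace.1 h2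
  refine tr_comp.2 ⟨u, hu, tr_comp.2 ⟨v, tr_ofTrace.2 ⟨h1, tr_comp.2 ⟨w, hw, tr_ofTrace.2
    ⟨fun a ha => ?_, fun c hc => ?_⟩⟩⟩, hs⟩⟩
  · obtain ⟨c, hc, hac⟩ := h3 a ha
    exact ⟨c, hc, h _ _ hac⟩
  · obtain ⟨a, ha, hac⟩ := h4 c hc
    exact ⟨a, ha, h _ _ hac⟩

/-- The approximations of `fix`. -/
def fixSeq (B : Coh) : ℕ → (bang (lolli (bang B) B) ⟶ B)
  | 0 => botMap _ _
  | n + 1 => stepMap (fixSeq B n)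

/-- The chain increases for inclusion of traces, so any two elements of the union lie in a common
trace; this is why the union is again a trace. -/
theorem fixSeq_mono (B : Coh) {m n : ℕ} (h : m ≤ n) (s : (bang (lolli (bang B) B)).web)
    (b : B.web) (hs : tr (fixSeq B m) s b) : tr (fixSeq B n) s b := by
  have key : ∀ n s b, tr (fixSeq B n) s b → tr (fixSeq B (n + 1)) s b := by
    intro n
    induction n with
    | zero => exact fun s b ⟨_, _, hs⟩ => hs.elim
    | succ n ih => exact stepMap_mono ih
  induction h with
  | refl => exact hs
  | step _ ih => exact key _ s b ih

/-- The fixpoint operator. -/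
def fixMap (B : Coh) : bang (lolli (bang B) B) ⟶ B :=
  ofTrace (fun s b => ∃ n, tr (fixSeq B n) s b) (by
    rintro s s' b b' hc ⟨m, hm⟩ ⟨n, hn⟩
    exact isTrace_tr (fixSeq B (max m n)) s s' b b' hc
      (fixSeq_mono B (le_max_left m n) s b hm) (fixSeq_mono B (le_max_right m n) s' b' hn))

theorem carrier_app_fixMap {B : Coh} (x : Clique (bang (lolli (bang B) B))) :
    (app (fixMap B) x).carrier = ⋃ n, (app (fixSeq B n) x).carrier := by
  ext b
  rw [Set.mem_iUnion]
  simp only [mem_app]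
  constructor
  · rintro ⟨s, hs, h⟩
    obtain ⟨n, hn⟩ := tr_ofTrace.1 h
    exact ⟨n, s, hs, hn⟩
  · rintro ⟨n, s, hs, hn⟩
    exact ⟨s, hs, tr_ofTrace.2 ⟨n, hn⟩⟩

theorem app_fixSeq_mono {B : Coh} (x : Clique (bang (lolli (bang B) B))) :
    Monotone fun n => (app (fixSeq B n) x).carrier := by
  intro m n h b hb
  obtain ⟨s, hs, h'⟩ := mem_app.1 hb
  exact mem_app.2 ⟨s, hs, fixSeq_mono B h s b h'⟩

theorem Clique.apply_mono {X Y : Coh} (t : Clique (lolli X Y)) {x x' : Clique X} (h : x ≤ x') :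
    t.apply x ≤ t.apply x' :=
  fun _ ⟨a, ha, hab⟩ => ⟨a, h ha, hab⟩

/-- Each stage is contained in the next, which is `t` applied to it. Conversely, a token of the
right side uses only a finite part of the union. -/
theorem app_fixMap {B : Coh} (t : Clique (lolli (bang B) B)) :
    app (fixMap B) t.promote = t.apply (app (fixMap B) t.promote).promote := by
  apply Clique.ext
  apply Set.Subset.antisymm
  · rw [carrier_app_fixMap]
    refine Set.iUnion_subset fun n => ?_
    have hle : app (fixSeq B n) t.promote ≤ app (fixMap B) t.promote := by
      rw [Clique.le_def, carrier_app_fixMap]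
      exact Set.subset_iUnion (fun n => (app (fixSeq B n) t.promote).carrier) n
    refine Set.Subset.trans (app_fixSeq_mono _ n.le_succ) ?_
    change (app (stepMap (fixSeq B n)) t.promote).carrier ⊆ _
    rw [app_stepMap]
    exact t.apply_mono (Clique.promote_mono hle)
  · rintro b ⟨s, hs, hb⟩
    have hs' : (s.1 : Set B.web) ⊆ ⋃ n, (app (fixSeq B n) t.promote).carrier := by
      rw [← carrier_app_fixMap]
      exact hs
    -- The finite set `s` already lies in a single stage `n`, so `b` appears at stage `n + 1`.
    obtain ⟨n, hn⟩ := Directed.exists_mem_subset_of_finset_subset_biUnion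
      (app_fixSeq_mono t.promote).directed_le hs'
    rw [carrier_app_fixMap]
    refine Set.mem_iUnion.2 ⟨n + 1, ?_⟩
    change b ∈ (app (stepMap (fixSeq B n)) t.promote).carrier
    rw [app_stepMap]
    exact ⟨s, hn, hb⟩

theorem fixMap_eq (B : Coh) : fixMap B =
    dMap _ ≫ tensorMap (counitMap _) (comultMap _ ≫ bangMap (fixMap B)) ≫ evalMap (bang B) B :=
  separating_promote _ fun t => by
    change _ = app (stepMap (fixMap B)) t.promote
    rw [app_stepMap, ← app_fixMap]

theorem isFixpoint_iff {B : Coh} {t : Clique (lolli (bang B) B)} {y : Clique B} :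
    IsFixpoint t y ↔ t.apply y.promote = y :=
  ⟨fun h => Clique.ext h, fun h => congrArg Clique.carrier h⟩

theorem isLeastFixOperator_fixMap : IsLeastFixOperator fixMap := by
  intro B t
  refine ⟨isFixpoint_iff.2 (app_fixMap t).symm, fun y hy => ?_⟩
  have hy' := isFixpoint_iff.1 hy
  change (app (fixMap B) t.promote).carrier ⊆ y.carrier
  rw [carrier_app_fixMap]
  refine Set.iUnion_subset fun n => ?_
  -- Every stage lies below `y`: the first is empty, and `t` is monotone and fixes `y`.
  induction n with
  | zero =>
    rintro b ⟨_, _, h⟩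
    exact h.elim
  | succ n ih =>
    change (app (stepMap (fixSeq B n)) t.promote).carrier ⊆ _
    rw [app_stepMap]
    exact (t.apply_mono (Clique.promote_mono ih)).trans hy'.le

/-! ## The structure of an `Sℓλ`-category -/

/-- Coherence spaces form an `Sℓλ`-category. -/
@[reducible] def cohSll : SllStructure cohLinear where
  nums := cohNumerals
  top := emptyCoh
  isTerminal := emptyCohIsTerminal
  prod := withProd
  fst := fstMap
  snd := sndMap
  isProd := withProdIsLimit
  lif := lifMap
  lif_zero := lifMap_zero
  lif_succ := lifMap_succ
  kleisli_cartesianClosed := cokleisli_cartesianClosed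
  fix := fixMap
  fix_eq B := by
    rw [reval_eq]
    exact fixMap_eq B

/-- All fields agree by definition except `curry` and `eval`, which pass through the adjunction and
the braiding. They are isolated as arguments of `mk` and rewritten there. -/
theorem cohSll_data : cohSll.data = cohData fixMap := by
  let mk (c : ∀ {Z A B : Coh}, (tensor Z A ⟶ B) → (Z ⟶ lolli A B))
      (e : ∀ A B : Coh, tensor (lolli A B) A ⟶ B) : SllData Coh :=
    { cohData fixMap with curry := c, eval := e }
  change mk (fun f => rcurry f) (fun A B => reval A B) = mk curryMap evalMap
  exact congrArg₂ (fun (c : ∀ (Z A B : Coh), (tensor Z A ⟶ B) → (Z ⟶ lolli A B)) e =>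
    mk (fun {Z A B} => c Z A B) e) (by funext Z A B f; exact rcurry_eq f)
    (by funext A B; exact reval_eq A B)

/-! ## The interpretation of the calculus -/

theorem SetEnv.cons_lift {Γ Δ : Basis} {y : Entry} (ρ : SetEnv Δ) (s : Set (cohTy y.ty).web)
    (r : Ren Γ Δ) :
    (fun x m => ρ.cons s x (r.lift y x m)) = SetEnv.cons (fun x m => ρ x (r x m)) s := by
  funext x m
  cases m <;> rfl

/-- The structural rules and those combining two bases rename their subterms; this turns the
renaming into a restriction of the environment. -/
theorem Tm.den_rename {Γ : Basis} {σ : Ty} (M : Tm Γ σ) :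
    ∀ {Δ : Basis} (r : Ren Γ Δ) (ρ : SetEnv Δ),
      (M.rename r).den ρ = M.den (fun x m => ρ x (r x m)) := by
  induction M with
  | zero | succ | pred | var | stable => intros; rfl
  | lif M L R ihM ihL ihR =>
    intro Δ r ρ
    simp only [Tm.rename, Tm.den, ihM, ihL, ihR]
  | app M N ihM ihN =>
    intro Δ r ρ
    simp only [Tm.rename, Tm.den, ihM, ihN]
  | lam M ih =>
    intro Δ r ρ
    simp only [Tm.rename, Tm.den, ih, SetEnv.cons_lift]
  | mu M ih =>
    intro Δ r ρ
    refine congrArg (fun Φ : Set _ → Set _ => ⋃ n : ℕ, Φ^[n] ∅) (funext fun s => ?_)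
    exact (ih _ _).trans (congrArg M.den (SetEnv.cons_lift (y := .stable _) ρ s r))

/-- The sets assigned to the variables by an environment. -/
def Env.sets {Γ : Basis} (ρ : Env Γ) : SetEnv Γ := fun x m => (ρ x m).carrier

/-- Restriction of an environment along a renaming. -/
def Env.comp {Γ Δ : Basis} (ρ : Env Δ) (r : Ren Γ Δ) : Env Γ := fun x m => ρ x (r x m)

theorem Env.IsGround.comp {Γ Δ : Basis} {ρ : Env Δ} (h : ρ.IsGround) (r : Ren Γ Δ) :
    (ρ.comp r).IsGround := fun m => h (r _ m)

/-- Extension of an environment. -/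
def Env.cons {Γ : Basis} {y : Entry} (ρ : Env Γ) (s : Clique (cohTy y.ty)) : Env (y :: Γ)
  | _, .head => s
  | _, .tail m => ρ _ m

theorem Env.sets_cons {Γ : Basis} {y : Entry} (ρ : Env Γ) (s : Clique (cohTy y.ty)) :
    (ρ.cons s).sets = ρ.sets.cons s.carrier := by
  funext x m
  cases m <;> rfl

/-- Abstraction is evaluated at single tokens, and a token of type `nat` is a number; so the
induction hypothesis applies under a `λ`. -/
theorem Env.IsGround.cons_single {Γ : Basis} {σ : Ty} {ρ : Env Γ} (h : ρ.IsGround)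
    (a : (cohTy σ).web) : (ρ.cons (y := .var σ) (Clique.single a)).IsGround := by
  intro m
  cases m with
  | head => exact ⟨a, rfl⟩
  | tail m => exact h m

theorem Env.IsGround.cons_stable {Γ : Basis} {σ : Ty} {ρ : Env Γ} (h : ρ.IsGround)
    (s : Clique (cohTy σ)) : (ρ.cons (y := .stable σ) s).IsGround := by
  intro m
  cases m with
  | tail m => exact h m

/-! ### The morphisms used by the interpretation, on cliques. -/

section Structural

variable {X Y Z W : Coh}

/-- Arbitrary coherence spaces stand here for interpretations of bases and types, so that the
evaluation rules apply directly; the fields of `cohData` unfold to these morphisms. -/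
theorem app_split_step {f : W ⟶ tensor X Y} {w : Clique W} {x : Clique X} {y : Clique Y}
    (h : app f w = x.tensor y) (z : Clique Z) :
    app (tensorMap f (𝟙 Z) ≫ (assocIso X Y Z).hom) (w.tensor z) = x.tensor (y.tensor z) := by
  simp [h]

theorem app_tensorMap_id_right {f : W ⟶ X} {w : Clique W} {x : Clique X} (h : app f w = x)
    (z : Clique Z) : app (tensorMap f (𝟙 Z)) (w.tensor z) = x.tensor z := by
  simp [h]

theorem app_exchange (x : Clique X) (y : Clique Y) (z : Clique Z) :
    app ((assocIso X Y Z).hom ≫ tensorMap (𝟙 X) (braidIso Y Z).hom ≫ (assocIso X Z Y).inv)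
      ((x.tensor y).tensor z) = (x.tensor z).tensor y := by
  simp

theorem app_promote_step {f : X ⟶ bang X} {g : Y ⟶ bang Y} {x : Clique X} {y : Clique Y}
    (hf : app f x = x.promote) (hg : app g y = y.promote) :
    app (tensorMap f g ≫ qMap X Y) (x.tensor y) = (x.tensor y).promote := by
  simp [hf, hg]

theorem app_weaken {g : Y ⟶ one} {y : Clique Y} (hg : app g y = Clique.star) (f : X ⟶ Z)
    (x : Clique X) :
    app (tensorMap (𝟙 X) g ≫ (runitIso X).hom ≫ f) (x.tensor y) = app f x := by
  simp [hg]

theorem app_contract {g : Y ⟶ tensor Y Y} {y : Clique Y} (hg : app g y = y.tensor y)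
    (f : tensor (tensor X Y) Y ⟶ Z) (x : Clique X) :
    app (tensorMap (𝟙 X) g ≫ (assocIso X Y Y).inv ≫ f) (x.tensor y) =
      app f ((x.tensor y).tensor y) := by
  simp [hg]

theorem app_application {s : W ⟶ tensor X Y} {w : Clique W} {x : Clique X} {y : Clique Y}
    (h : app s w = x.tensor y) {A B : Coh} (f : X ⟶ lolli A B) (g : Y ⟶ A) :
    app (s ≫ tensorMap f g ≫ evalMap A B) w = (app f x).apply (app g y) := by
  simp [h]

theorem app_conditional {s : W ⟶ tensor X Y} {w : Clique W} {x : Clique X} {y : Clique Y}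
    (h : app s w = x.tensor y) (f : X ⟶ natCoh) (g k : Y ⟶ natCoh) :
    app (s ≫ tensorMap f (pairMap g k) ≫ lifMap) w =
      app lifMap ((app f x).tensor ((app g y).pair (app k y))) := by
  simp [h]

theorem app_recursion {s : X ⟶ bang X} {x : Clique X} (h : app s x = x.promote)
    (f : tensor X (bang Y) ⟶ Y) :
    app (s ≫ bangMap (curryMap f) ≫ fixMap Y) x = app (fixMap Y) (app (curryMap f) x).promote := by
  simp [h]

/-- One step applies the curried clique to a promotion, which by `h` is one application of `Φ`.
Although `Φ` is controlled only on cliques, its iterates on `∅` are carriers of stages, hence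
cliques. -/
theorem app_fixSeq_curryMap {Φ : Set Y.web → Set Y.web} {x : Clique X}
    {f : tensor X (bang Y) ⟶ Y}
    (h : ∀ y : Clique Y, (app f (x.tensor y.promote)).carrier = Φ y.carrier) (n : ℕ) :
    (app (fixSeq Y n) (app (curryMap f) x).promote).carrier = Φ^[n] ∅ := by
  induction n with
  | zero => exact Set.eq_empty_of_forall_notMem fun b ⟨_, _, hb⟩ => hb
  | succ n ih =>
    change (app (stepMap (fixSeq Y n)) _).carrier = _
    rw [app_stepMap, apply_curryMap, h, ih, Function.iterate_succ_apply']

theorem carrier_app_recursion {Φ : Set Y.web → Set Y.web} {s : X ⟶ bang X} {x : Clique X}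
    (hs : app s x = x.promote) {f : tensor X (bang Y) ⟶ Y}
    (h : ∀ y : Clique Y, (app f (x.tensor y.promote)).carrier = Φ y.carrier) :
    (app (s ≫ bangMap (curryMap f) ≫ fixMap Y) x).carrier = ⋃ n, Φ^[n] ∅ := by
  rw [app_recursion hs, carrier_app_fixMap]
  exact Set.iUnion_congr fun n => app_fixSeq_curryMap h n

theorem mem_app_curryMap {f : tensor Z X ⟶ Y} {z : Clique Z} {a : X.web} {b : Y.web} :
    ((a, b) : (lolli X Y).web) ∈ (app (curryMap f) z).carrier ↔
      b ∈ (app f (z.tensor (Clique.single a))).carrier := by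
  rw [← apply_curryMap]
  exact ⟨fun h => ⟨a, rfl, h⟩, by rintro ⟨_, rfl, h⟩; exact h⟩

theorem app_lunitIso_comp (f : X ⟶ Y) (x : Clique X) :
    app ((lunitIso X).hom ≫ f) (Clique.star.tensor x) = app f x := by
  simp

end Structural

/-- The clique of a variable of a basis given by a clique of its type. -/
def Entry.clique (fix : ∀ B : Coh, bang (lolli (bang B) B) ⟶ B) :
    ∀ x : Entry, Clique (cohTy x.ty) → Clique ((cohData fix).entry x)
  | .var _, s => s
  | .stable _, s => s.promote

section

variable (fix : ∀ B : Coh, bang (lolli (bang B) B) ⟶ B)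

/-- Both kinds of entry receive the same form, which spares case distinctions in the inductions over
bases. -/
theorem Env.clique_cons (x : Entry) (Γ : Basis) (ρ : Env (x :: Γ)) :
    Env.clique fix (x :: Γ) ρ =
      Clique.tensor (X := (cohData fix).basis Γ) (Y := (cohData fix).entry x)
        (Env.clique fix Γ (ρ.comp (Ren.weaken Γ x))) (x.clique fix (ρ x .head)) := by
  cases x <;> rfl

theorem app_split (Γ : Basis) : ∀ (Δ : Basis) (ρ : Env (Δ ++ Γ)),
    app ((cohData fix).split Γ Δ) (Env.clique fix (Δ ++ Γ) ρ) =
      Clique.tensor (X := (cohData fix).basis Γ) (Y := (cohData fix).basis Δ)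
        (Env.clique fix Γ (ρ.comp (Ren.left Γ Δ))) (Env.clique fix Δ (ρ.comp (Ren.right Γ Δ)))
  | [], ρ => app_runitIso_inv (X := (cohData fix).basis Γ) (Env.clique fix Γ ρ)
  | x :: Δ, ρ => by
    have ih := app_split Γ Δ (ρ.comp (Ren.weaken (Δ ++ Γ) x))
    have e1 := Env.clique_cons fix x (Δ ++ Γ) ρ
    have e2 := Env.clique_cons fix x Δ (ρ.comp (Ren.right Γ (x :: Δ)))
    refine (congrArg _ e1).trans ((app_split_step ih _).trans ?_)
    exact congrArg (Clique.tensor (X := (cohData fix).basis Γ)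
      (Y := (cohData fix).basis (x :: Δ)) _) e2.symm

theorem app_exchange_clique (Γ : Basis) (x y : Entry) : ∀ (Δ : Basis) (ρ : Env (Δ ++ y :: x :: Γ)),
    app ((cohData fix).exchange Γ x y Δ) (Env.clique fix (Δ ++ y :: x :: Γ) ρ) =
      Env.clique fix (Δ ++ x :: y :: Γ) (ρ.comp (Ren.exchange Γ x y Δ))
  | [], ρ => by
    cases x <;> cases y <;> exact app_exchange _ _ _
  | z :: Δ, ρ => by
    have ih := app_exchange_clique Γ x y Δ (ρ.comp (Ren.weaken _ z))
    have e1 := Env.clique_cons fix z (Δ ++ y :: x :: Γ) ρ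
    have e2 := Env.clique_cons fix z (Δ ++ x :: y :: Γ) (ρ.comp (Ren.exchange Γ x y (z :: Δ)))
    exact (congrArg _ e1).trans ((app_tensorMap_id_right ih _).trans e2.symm)

/-- Groundness is essential: `p` agrees with promotion on numerals but not on the empty clique. -/
theorem app_promoteGround : ∀ (n : ℕ) (ρ : Env (List.replicate n (.var .nat))), ρ.IsGround →
    app ((cohData fix).promoteGround n) (Env.clique fix _ ρ) =
      Clique.promote (X := (cohData fix).basis _) (Env.clique fix _ ρ)
  | 0, _, _ => app_qUnitMap
  | n + 1, ρ, h => by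
    obtain ⟨k, hk⟩ := h .head
    have hp : app pMap (ρ (.var .nat) .head) = Clique.promote (ρ (.var .nat) .head) := by
      rw [hk]
      exact app_pMap k
    exact app_promote_step
      (app_promoteGround n (ρ.comp (Ren.weaken _ _)) (h.comp (Ren.weaken _ _))) hp

theorem app_promote (n : ℕ) : ∀ (Δ : List Ty) (ρ : Env (groundStable n Δ)), ρ.IsGround →
    app ((cohData fix).promote n Δ) (Env.clique fix _ ρ) =
      Clique.promote (X := (cohData fix).basis _) (Env.clique fix _ ρ)
  | [], ρ, h => app_promoteGround fix n ρ h
  | _ :: Δ, ρ, h => app_promote_step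
      (app_promote n Δ (ρ.comp (Ren.weaken _ _)) (h.comp (Ren.weaken _ _)))
      (app_comultMap (ρ (.stable _) .head))

end

/-- Induction on the derivation: the morphism of each rule carries the clique of `ρ` to those of the
environments of the premises, and the remaining operation matches the clause of `Tm.den`. -/
theorem carrier_app_interp {Γ : Basis} {σ : Ty} {M : Tm Γ σ} (dM : Der M) :
    ∀ ρ : Env Γ, ρ.IsGround →
      (app ((cohData fixMap).interp dM) (Env.clique fixMap Γ ρ)).carrier = M.den ρ.sets := by
  induction dM with
  | z => exact fun _ _ => congrArg Clique.carrier app_zeroMap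
  | s =>
    intro ρ _
    ext ⟨a, b⟩
    refine (mem_app_curryMap (Z := one) (X := natCoh) (Y := natCoh)).trans ?_
    refine (iff_of_eq (congrArg (fun y => b ∈ Clique.carrier y)
      (app_lunitIso_comp succMap (Clique.num a)))).trans ?_
    exact ⟨by rintro ⟨_, rfl, h⟩; exact h, fun h => ⟨a, rfl, h⟩⟩
  | p =>
    intro ρ _
    ext ⟨a, b⟩
    refine (mem_app_curryMap (Z := one) (X := natCoh) (Y := natCoh)).trans ?_
    refine (iff_of_eq (congrArg (fun y => b ∈ Clique.carrier y)
      (app_lunitIso_comp predMap (Clique.num a)))).trans ?_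
    exact ⟨by rintro ⟨_, rfl, h⟩; exact h, fun h => ⟨a, rfl, h⟩⟩
  | @lif Γ Δ M L R dM dL dR ihM ihL ihR =>
    intro ρ h
    have e := app_conditional (app_split fixMap Γ Δ ρ) ((cohData fixMap).interp dM)
      ((cohData fixMap).interp dL) ((cohData fixMap).interp dR)
    ext m
    refine (iff_of_eq (congrArg (fun y => m ∈ Clique.carrier y) e)).trans ?_
    refine mem_app_lifMap.trans ?_
    have hM := ihM _ (h.comp (Ren.left Γ Δ))
    have hL := ihL _ (h.comp (Ren.right Γ Δ))
    have hR := ihR _ (h.comp (Ren.right Γ Δ))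
    simp only [Tm.den, Tm.den_rename]
    refine or_congr (and_congr ?_ ?_) (and_congr (exists_congr fun n => ?_) ?_)
    · exact iff_of_eq (congrArg ((0 : ℕ) ∈ ·) hM)
    · exact iff_of_eq (congrArg (m ∈ ·) hL)
    · exact iff_of_eq (congrArg (n + 1 ∈ ·) hM)
    · exact iff_of_eq (congrArg (m ∈ ·) hR)
  | @ex Γ Δ x y τ M dM ih =>
    intro ρ h
    rw [Tm.den_rename]
    refine Eq.trans ?_ (ih _ (h.comp (Ren.exchange Γ x y Δ)))
    exact congrArg (fun c => (app ((cohData fixMap).interp dM) c).carrier)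
      (app_exchange_clique fixMap Γ x y Δ ρ)
  | v σ => exact fun ρ _ => congrArg Clique.carrier (app_lunitIso_hom (ρ (.var σ) .head))
  | @gw Γ τ M dM ih =>
    intro ρ h
    rw [Tm.den_rename]
    refine Eq.trans ?_ (ih _ (h.comp (Ren.weaken Γ _)))
    -- On an empty clique `w` would give the empty clique instead of the unit token; the numeral `n`
    -- excludes this.
    obtain ⟨n, hn⟩ := h .head
    have hw : app wMap (ρ (.var .nat) .head) = Clique.star := by
      rw [hn]
      exact app_wMap n
    exact congrArg Clique.carrier (app_weaken hw ((cohData fixMap).interp dM) _)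
  | @gc Γ τ M dM ih =>
    intro ρ h
    rw [Tm.den_rename]
    refine Eq.trans ?_ (ih _ (h.comp (Ren.contract Γ _)))
    obtain ⟨n, hn⟩ := h .head
    have hc : app cMap (ρ (.var .nat) .head) =
        (ρ (.var .nat) .head).tensor (ρ (.var .nat) .head) := by
      rw [hn]
      exact app_cMap n
    exact congrArg Clique.carrier (app_contract hc ((cohData fixMap).interp dM) _)
  | @ap Γ Δ σ τ M N dM dN ihM ihN =>
    intro ρ h
    have e := app_application (app_split fixMap Γ Δ ρ) (A := cohTy σ) (B := cohTy τ)
      ((cohData fixMap).interp dM) ((cohData fixMap).interp dN)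
    refine (congrArg Clique.carrier e).trans ?_
    have hM := ihM _ (h.comp (Ren.left Γ Δ))
    have hN := ihN _ (h.comp (Ren.right Γ Δ))
    simp only [Tm.den, Tm.den_rename]
    ext b
    refine exists_congr fun a => and_congr ?_ ?_
    · exact iff_of_eq (congrArg (a ∈ ·) hN)
    · exact iff_of_eq (congrArg ((a, b) ∈ ·) hM)
  | @lam Γ σ τ M dM ih =>
    intro ρ h
    ext ⟨a, b⟩
    -- A token `(a, b)` of a curried map records the value at `{a}`, which is the environment used
    -- by the clause for `λ`.
    have e := ih _ (h.cons_single a)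
    rw [Env.sets_cons] at e
    refine (mem_app_curryMap (Z := (cohData fixMap).basis Γ) (X := cohTy σ)
      (Y := cohTy τ)).trans ?_
    exact iff_of_eq (congrArg (b ∈ ·) e)
  | sv σ =>
    intro ρ _
    exact congrArg Clique.carrier ((app_lunitIso_comp (counitMap (cohTy σ)) _).trans
      (app_counitMap (ρ (.stable σ) .head)))
  | @sc Γ σ τ M dM ih =>
    intro ρ h
    rw [Tm.den_rename]
    refine Eq.trans ?_ (ih _ (h.comp (Ren.contract Γ _)))
    exact congrArg Clique.carrier
      (app_contract (app_dMap (ρ (.stable σ) .head)) ((cohData fixMap).interp dM) _)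
  | @sw Γ σ τ M dM ih =>
    intro ρ h
    rw [Tm.den_rename]
    refine Eq.trans ?_ (ih _ (h.comp (Ren.weaken Γ _)))
    exact congrArg Clique.carrier
      (app_weaken (app_eMap (ρ (.stable σ) .head)) ((cohData fixMap).interp dM) _)
  | @mu n Δ σ M dM ih =>
    intro ρ h
    -- The basis has only ground and stable variables, so its clique is promoted as a whole, and the
    -- fixpoint is that of the semantic operator of `M`.
    refine carrier_app_recursion (app_promote fixMap n Δ ρ h)
      (Φ := fun s => M.den (ρ.sets.cons (x := .stable σ) s)) fun y => ?_
    exact (ih _ (h.cons_stable y)).trans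
      (congrArg M.den (Env.sets_cons (y := .stable σ) ρ y))

end Sll

theorem mainTheorem4 :
    ∃ fix : ∀ B : Sll.Coh, Sll.bang (Sll.lolli (Sll.bang B) B) ⟶ B,
      Sll.IsLeastFixOperator fix ∧
      (∃ (_ : MonoidalCategory Sll.Coh) (_ : SymmetricCategory Sll.Coh)
        (_ : MonoidalClosed Sll.Coh) (L : Sll.LinearCategory Sll.Coh) (S : Sll.SllStructure L),
        S.data = Sll.cohData fix) ∧
      Sll.RecoversConcreteModel fix := by
  exact ⟨Sll.fixMap, Sll.isLeastFixOperator_fixMap,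
    ⟨inferInstance, inferInstance, inferInstance, Sll.cohLinear, Sll.cohSll, Sll.cohSll_data⟩,
    fun _ _ _ dM ρ h => Sll.carrier_app_interp dM ρ h⟩
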